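/- A lattice polygon is the convex hull of a nonempty finite subset of $\mathbb Z^2$ in $\mathbb R^2$ (so points and lattice segments are allowed). For such polygons $P,Q$ let $P+Q$ be the Minkowski sum, $P^\circ$ the interior of $P$ in $\mathbb R^2$, $l_P(v)=\max\{u\cdot v: u\in P\}$ the support function, and $V(P,Q)=V(P+Q)-V(P)-V(Q)$ the normalized mixed area, where $V(\cdot)$ is the Euclidean area. For a bounded set $X\subset\mathbb R^2$ let $|X|_{\mathbb Z}=|X\cap\mathbb Z^2|$, and for $X,Y\subset\mathbb R^2$ let $X-Y=\{u\in\mathbb R^2: u+Y\subseteq X\}$. Let $\operatorname{Fan}(P)$ be the set of primitive vectors of $\mathbb Z^2$ (coprime coordinates) that are outer normals to the edges of $P$. \textbf{Theorem.} Let $P_1,R_1,R_2$ be lattice polygons with $P_1$ two-dimensional, and let $A=P_1+R_1$ and $P_2=A+R_2$. Then the three conditions (i) $V(P_1,A)<V(P_1,P_2)$, (ii) $2A\subseteq(P_1+P_2)^\circ$, (iii) $|A|_{\mathbb Z}-|A-P_1|_{\mathbb Z}=V(P_1,P_2)/2$ all hold if and only if $R_1\subset R_2^\circ$ and $l_{R_2}(v)=l_{R_1}(v)+1$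 for every $v\in\operatorname{Fan}(P_1)$. -/

import Mathlib

open MeasureTheory
open scoped Pointwise

noncomputable section

/-- The point of `ℝ²` with the given integer coordinates. -/
def latticePt (z : Fin 2 → ℤ) : Fin 2 → ℝ := fun i => (z i : ℝ)

/-- A lattice polygon: the convex hull of a nonempty finite set of lattice points in `ℝ²`
(points and lattice segments are allowed). -/
def IsLatticePolygon (P : Set (Fin 2 → ℝ)) : Prop :=
  ∃ s : Finset (Fin 2 → ℤ), s.Nonempty ∧ P = convexHull ℝ (latticePt '' (s : Set (Fin 2 → ℤ)))

/-- The number of lattice points of a (bounded) set `P`. -/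
def latticeCount (P : Set (Fin 2 → ℝ)) : ℕ :=
  {z : Fin 2 → ℤ | latticePt z ∈ P}.ncard

/-- The support function `l_P(v) = max {u · v | u ∈ P}` of a nonempty compact set `P`. -/
def supportFun (P : Set (Fin 2 → ℝ)) (v : Fin 2 → ℝ) : ℝ :=
  sSup ((fun u => u ⬝ᵥ v) '' P)

/-- The area (two-dimensional Lebesgue measure) of `P`. -/
def area (P : Set (Fin 2 → ℝ)) : ℝ := (volume P).toReal

/-- The normalized mixed area `V(P, Q) = V(P + Q) - V(P) - V(Q)`. -/
def mixedArea (P Q : Set (Fin 2 → ℝ)) : ℝ := area (P + Q) - area P - area Q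

/-- The difference `A - B = {u | u + B ⊆ A}`
(not the pointwise difference of sets). -/
def minkowskiDiff (A B : Set (Fin 2 → ℝ)) : Set (Fin 2 → ℝ) :=
  {u | ∀ b ∈ B, u + b ∈ A}

/-- The face of `P` on which the linear functional `u ↦ u · v` attains its maximum over `P`. -/
def face (P : Set (Fin 2 → ℝ)) (v : Fin 2 → ℝ) : Set (Fin 2 → ℝ) :=
  {u | u ∈ P ∧ u ⬝ᵥ v = supportFun P v}

/-- The primitive lattice vectors that are outer normals to the edges of `P`. For a nonzero `v`,
the face of a polygon in direction `v` is a vertex or an edge; it is an edge exactly when it has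
more than one point. -/
def fan (P : Set (Fin 2 → ℝ)) : Set (Fin 2 → ℤ) :=
  {v | IsCoprime (v 0) (v 1) ∧ (face P (latticePt v)).Nontrivial}

end

section

open Set Filter Topology

/-! Write `l_K` for the support function of `K`, and let `edgeSum P φ` be the sum of `φ v` over the
primitive outer edge normals `v` of `P`, weighted by the lattice lengths of the edges. Two formulas
reduce everything to support functions: the mixed area formula V(P, R) = `edgeSum P l_R`
(`IsLatticePolygon.mixedArea_eq`) and Pick's formula 2|P| = 2 area(P) + `edgeSum P 1` + 2
(`IsLatticePolygon.pick`), which also covers points and segments.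

Since P₁ + P₂ = 2P₁ + R₁ + R₂ and 2A = 2P₁ + 2R₁, condition (ii) says that l_{R₁} < l_{R₂} in all
nonzero directions, which is R₁ ⊂ R₂°. Minkowski cancellation gives A - P₁ = R₁, so Pick's formula
for A and R₁ turns (iii) into the vanishing of `edgeSum P₁ (l_{R₂} - l_{R₁} - 1)`. Support functions
of lattice polygons take integer values on lattice vectors; hence under (ii) every term of this sum
is nonnegative, and the sum vanishes exactly when l_{R₂} = l_{R₁} + 1 on the fan. Condition (i) then
comes for free: its two sides differ by V(P₁, R₂), which is positive because P₁ and R₂ have interior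
points.

Both formulas are proved by one scheme. The defect of the formula is additive when a polygon is cut
by a line and invariant under lattice translations, so by `CutAdditive.eq_zero` only segments and
triangles matter. A doubled triangle splits into two translates of the triangle and a parallelogram,
and the parallelogram into the triangle and its point reflection. The mixed area defect vanishes on
parallelograms, so it doubles with the triangle; a circumscribed triangle bounds it above by a
constant, so it is nonpositive, and since triangle and reflection have total defect zero, both
defects vanish. The Pick defect is invariant under reflection, so it grows by the factor 4, like the
area; lattice point counts are asymptotic to areas and the edge sum only doubles, so it vanishes
too. -/

/-- A convex body in the plane: a nonempty compact convex set. -/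
structure IsBody (K : Set (Fin 2 → ℝ)) : Prop where
  convex : Convex ℝ K
  compact : IsCompact K
  nonempty : K.Nonempty

/-- Rotation of the plane by a right angle, clockwise. -/
def rot (x : Fin 2 → ℝ) : Fin 2 → ℝ := ![x 1, -x 0]

/-- The determinant of two plane vectors. -/
def cross (x y : Fin 2 → ℝ) : ℝ := x 0 * y 1 - x 1 * y 0

/-! ### Scalar products in the plane -/

theorem dot_eq (x y : Fin 2 → ℝ) : x ⬝ᵥ y = x 0 * y 0 + x 1 * y 1 := by
  simp [dotProduct, Fin.sum_univ_two]

theorem continuous_dot (v : Fin 2 → ℝ) : Continuous fun u : Fin 2 → ℝ => u ⬝ᵥ v := by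
  simp only [dot_eq]; fun_prop

theorem isLinearMap_dot (v : Fin 2 → ℝ) : IsLinearMap ℝ fun y : Fin 2 → ℝ => y ⬝ᵥ v :=
  ⟨fun a b => add_dotProduct a b v, fun a b => smul_dotProduct a b v⟩

theorem exists_combination_eq {x y c : ℝ} (hx : x ≤ c) (hy : c ≤ y) :
    ∃ t : ℝ, 0 ≤ t ∧ t ≤ 1 ∧ (1 - t) * x + t * y = c := by
  rcases eq_or_lt_of_le (hx.trans hy) with he | hlt
  · exact ⟨0, le_rfl, zero_le_one, by linarith⟩
  · have hd : 0 < y - x := sub_pos.2 hlt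
    refine ⟨(c - x) / (y - x), div_nonneg (by linarith) hd.le,
      (div_le_one hd).2 (by linarith), ?_⟩
    field_simp
    ring

theorem plane_ext {x y : Fin 2 → ℝ} (h0 : x 0 = y 0) (h1 : x 1 = y 1) : x = y := by
  ext i; fin_cases i <;> assumption

theorem exists_eq_dot (f : (Fin 2 → ℝ) →ₗ[ℝ] ℝ) : ∃ v, ∀ x, f x = x ⬝ᵥ v := by
  refine ⟨![f ![1, 0], f ![0, 1]], fun x => ?_⟩
  have hx : x = x 0 • ![1, 0] + x 1 • ![0, 1] := plane_ext (by simp) (by simp)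
  conv_lhs => rw [hx]
  rw [map_add, map_smul, map_smul, dot_eq]
  simp

theorem dot_self_pos {v : Fin 2 → ℝ} (hv : v ≠ 0) : 0 < v ⬝ᵥ v := by
  rw [dot_eq]
  by_contra h
  apply hv
  have h0 : v 0 = 0 := by nlinarith [sq_nonneg (v 0), sq_nonneg (v 1)]
  have h1 : v 1 = 0 := by nlinarith [sq_nonneg (v 0), sq_nonneg (v 1)]
  exact plane_ext h0 h1

/-! ### Convex bodies and their support functions -/

namespace IsBody

variable {K L : Set (Fin 2 → ℝ)}

theorem bddAbove (hK : IsBody K) (v : Fin 2 → ℝ) : BddAbove ((fun u => u ⬝ᵥ v) '' K) :=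
  (hK.compact.image (continuous_dot v)).bddAbove

theorem le_supportFun (hK : IsBody K) {x : Fin 2 → ℝ} (hx : x ∈ K) (v : Fin 2 → ℝ) :
    x ⬝ᵥ v ≤ supportFun K v :=
  le_csSup (hK.bddAbove v) ⟨x, hx, rfl⟩

theorem supportFun_le (hK : IsBody K) {v : Fin 2 → ℝ} {c : ℝ} (h : ∀ x ∈ K, x ⬝ᵥ v ≤ c) :
    supportFun K v ≤ c := by
  refine csSup_le (hK.nonempty.image _) ?_
  rintro _ ⟨x, hx, rfl⟩
  exact h x hx

theorem exists_mem_supportFun (hK : IsBody K) (v : Fin 2 → ℝ) :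
    ∃ x ∈ K, x ⬝ᵥ v = supportFun K v := by
  obtain ⟨x, hx, h⟩ := hK.compact.exists_isMaxOn hK.nonempty (continuous_dot v).continuousOn
  exact ⟨x, hx, le_antisymm (hK.le_supportFun hx v) (hK.supportFun_le fun y hy => h hy)⟩

theorem supportFun_eq (hK : IsBody K) {v x : Fin 2 → ℝ} (hx : x ∈ K)
    (h : ∀ y ∈ K, y ⬝ᵥ v ≤ x ⬝ᵥ v) : supportFun K v = x ⬝ᵥ v :=
  le_antisymm (hK.supportFun_le h) (hK.le_supportFun hx v)

theorem add (hK : IsBody K) (hL : IsBody L) : IsBody (K + L) :=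
  ⟨hK.convex.add hL.convex, hK.compact.add hL.compact, hK.nonempty.add hL.nonempty⟩

theorem singleton (x : Fin 2 → ℝ) : IsBody {x} :=
  ⟨convex_singleton x, isCompact_singleton, singleton_nonempty x⟩

theorem smul (hK : IsBody K) (c : ℝ) : IsBody (c • K) :=
  ⟨hK.convex.smul c, hK.compact.smul c, hK.nonempty.smul_set⟩

theorem supportFun_add (hK : IsBody K) (hL : IsBody L) (v : Fin 2 → ℝ) :
    supportFun (K + L) v = supportFun K v + supportFun L v := by
  obtain ⟨x, hx, hxv⟩ := hK.exists_mem_supportFun v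
  obtain ⟨y, hy, hyv⟩ := hL.exists_mem_supportFun v
  rw [(hK.add hL).supportFun_eq (Set.add_mem_add hx hy), add_dotProduct, hxv, hyv]
  rintro _ ⟨a, ha, b, hb, rfl⟩
  simp only [add_dotProduct, hxv, hyv]
  exact add_le_add (hK.le_supportFun ha v) (hL.le_supportFun hb v)

theorem supportFun_singleton (x v : Fin 2 → ℝ) : supportFun {x} v = x ⬝ᵥ v := by
  simp [supportFun]

theorem supportFun_smul_set (hK : IsBody K) {c : ℝ} (hc : 0 ≤ c) (v : Fin 2 → ℝ) :
    supportFun (c • K) v = c * supportFun K v := by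
  obtain ⟨x, hx, hxv⟩ := hK.exists_mem_supportFun v
  rw [(hK.smul c).supportFun_eq (smul_mem_smul_set hx), smul_dotProduct, hxv, smul_eq_mul]
  rintro _ ⟨a, ha, rfl⟩
  simp only [smul_dotProduct, smul_eq_mul]
  exact mul_le_mul_of_nonneg_left (by rw [hxv]; exact hK.le_supportFun ha v) hc

theorem supportFun_smul (hK : IsBody K) {c : ℝ} (hc : 0 ≤ c) (v : Fin 2 → ℝ) :
    supportFun K (c • v) = c * supportFun K v := by
  obtain ⟨x, hx, hxv⟩ := hK.exists_mem_supportFun v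
  rw [hK.supportFun_eq hx, dotProduct_smul, hxv, smul_eq_mul]
  intro a ha
  simp only [dotProduct_smul, smul_eq_mul]
  exact mul_le_mul_of_nonneg_left (by rw [hxv]; exact hK.le_supportFun ha v) hc

theorem supportFun_zero (hK : IsBody K) : supportFun K 0 = 0 := by
  simpa using hK.supportFun_smul le_rfl 0

theorem supportFun_mono (hK : IsBody K) (hL : IsBody L) (h : K ⊆ L) (v : Fin 2 → ℝ) :
    supportFun K v ≤ supportFun L v :=
  hK.supportFun_le fun _ hx => hL.le_supportFun (h hx) v

/-- By separation, a convex body is the intersection of its supporting half-planes. -/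
theorem mem_of_forall_le (hK : IsBody K) {x : Fin 2 → ℝ}
    (h : ∀ v, x ⬝ᵥ v ≤ supportFun K v) : x ∈ K := by
  by_contra hx
  obtain ⟨f, u, h1, h2⟩ := geometric_hahn_banach_closed_point hK.convex hK.compact.isClosed hx
  obtain ⟨v, hv⟩ := exists_eq_dot f.toLinearMap
  have hv' : ∀ y, f y = y ⬝ᵥ v := hv
  have := hK.supportFun_le (v := v) (c := u) fun y hy => by rw [← hv']; exact (h1 y hy).le
  have := h v
  rw [← hv'] at this
  linarith

/-- A convex body is contained in the interior of another one exactly when its support function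
is strictly smaller in every nonzero direction. -/
theorem subset_interior_of_supportFun_lt (hK : IsBody K) (hL : IsBody L)
    (h : ∀ v, v ≠ 0 → supportFun K v < supportFun L v) : K ⊆ interior L := by
  -- A body without interior points lies in a line. For a normal `v` of that line the values of
  -- `supportFun L` at `v` and `-v` add up to zero, which leaves no room for the strict inequalities
  -- at both.
  have hne : (interior L).Nonempty := by
    rw [hL.convex.interior_nonempty_iff_affineSpan_eq_top]
    by_contra hspan
    have hd : (affineSpan ℝ L).direction < ⊤ := by
      rw [lt_top_iff_ne_top]
      intro hd
      exact hspan ((AffineSubspace.direction_eq_top_iff_of_nonempty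
        ((affineSpan_nonempty ℝ).2 hL.nonempty)).1 hd)
    obtain ⟨f, hf0, hf⟩ := Submodule.exists_le_ker_of_lt_top _ hd
    obtain ⟨v, hv⟩ := exists_eq_dot f
    have hv0 : v ≠ 0 := by
      rintro rfl
      exact hf0 (LinearMap.ext fun x => by simp [hv])
    obtain ⟨y, hy, hyv⟩ := hL.exists_mem_supportFun v
    obtain ⟨z, hz, hzv⟩ := hL.exists_mem_supportFun (-v)
    obtain ⟨x, hx⟩ := hK.nonempty
    have e : f (y - z) = 0 := hf (AffineSubspace.vsub_mem_direction
      (subset_affineSpan ℝ L hy) (subset_affineSpan ℝ L hz))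
    rw [hv, sub_dotProduct] at e
    rw [dotProduct_neg] at hzv
    have h1 := hK.le_supportFun hx v
    have h2 := hK.le_supportFun hx (-v)
    rw [dotProduct_neg] at h2
    have h3 := h v hv0
    have h4 := h (-v) (neg_ne_zero.2 hv0)
    linarith
  intro x hx
  by_contra hxL
  obtain ⟨f, hf⟩ := geometric_hahn_banach_open_point hL.convex.interior isOpen_interior hxL
  obtain ⟨v, hv⟩ := exists_eq_dot f.toLinearMap
  have hv' : ∀ y, f y = y ⬝ᵥ v := hv
  have hv0 : v ≠ 0 := by
    rintro rfl
    obtain ⟨y, hy⟩ := hne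
    have := hf y hy
    simp [hv'] at this
  -- The separating inequality is known on the interior and extends to `L` because `L` lies in the
  -- closure of its interior.
  have hle : ∀ y ∈ L, y ⬝ᵥ v ≤ x ⬝ᵥ v := by
    intro y hy
    have hy' : y ∈ closure (interior L) := by
      rw [hL.convex.closure_interior_eq_closure_of_nonempty_interior hne]
      exact subset_closure hy
    refine closure_minimal (t := {y | y ⬝ᵥ v ≤ x ⬝ᵥ v}) ?_
      (isClosed_le (continuous_dot v) continuous_const) hy'
    intro z hz
    have := hf z hz
    rw [hv', hv'] at this
    exact this.le
  have := hL.supportFun_le hle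
  have := hK.le_supportFun hx v
  have := h v hv0
  linarith

/-- A maximiser over `K` can be moved a little in the direction `v` without leaving `L`. -/
theorem supportFun_lt_of_subset_interior (hK : IsBody K) (hL : IsBody L)
    (h : K ⊆ interior L) {v : Fin 2 → ℝ} (hv : v ≠ 0) : supportFun K v < supportFun L v := by
  obtain ⟨x, hx, hxv⟩ := hK.exists_mem_supportFun v
  have hmem : ∀ᶠ t : ℝ in 𝓝[>] 0, x + t • v ∈ L := by
    have hc : Tendsto (fun t : ℝ => x + t • v) (𝓝[>] 0) (𝓝 x) := by
      have : Continuous fun t : ℝ => x + t • v := by fun_prop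
      have := this.tendsto 0
      simp only [zero_smul, add_zero] at this
      exact this.mono_left nhdsWithin_le_nhds
    exact hc (mem_interior_iff_mem_nhds.1 (h hx))
  obtain ⟨t, ht, ht0⟩ := (hmem.and self_mem_nhdsWithin).exists
  have := hL.le_supportFun ht v
  rw [add_dotProduct, smul_dotProduct, smul_eq_mul, hxv] at this
  have := mul_pos (show (0 : ℝ) < t from ht0) (dot_self_pos hv)
  linarith

/-- Minkowski cancellation: testing the translate by `u` at a maximiser over `K` in direction `v`
cancels `supportFun K v` and leaves the supporting inequality for `L`. -/
theorem minkowskiDiff_add_eq (hK : IsBody K) (hL : IsBody L) : minkowskiDiff (K + L) K = L := by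
  ext u
  constructor
  · intro hu
    refine hL.mem_of_forall_le fun v => ?_
    obtain ⟨x, hx, hxv⟩ := hK.exists_mem_supportFun v
    have := (hK.add hL).le_supportFun (hu x hx) v
    rw [hK.supportFun_add hL, add_dotProduct, hxv] at this
    linarith
  · intro hu b hb
    rw [add_comm u b]
    exact Set.add_mem_add hb hu

end IsBody

/-- The support functions of the two parts of a convex body cut by a line, together with the
support functions of the whole body and of the section. -/
theorem supportFun_cut {K : Set (Fin 2 → ℝ)} (hK : IsBody K) {n : Fin 2 → ℝ} {c : ℝ}
    (h1 : IsBody (K ∩ {x | x ⬝ᵥ n ≤ c})) (h2 : IsBody (K ∩ {x | c ≤ x ⬝ᵥ n}))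
    (h3 : IsBody (K ∩ {x | x ⬝ᵥ n = c})) (v : Fin 2 → ℝ) :
    supportFun K v + supportFun (K ∩ {x | x ⬝ᵥ n = c}) v =
      supportFun (K ∩ {x | x ⬝ᵥ n ≤ c}) v + supportFun (K ∩ {x | c ≤ x ⬝ᵥ n}) v := by
  -- The segment from `x` to `y` crosses the line inside `K`, and a convex combination is at least
  -- the minimum. Thus the whole body has the maximum of the two support values and the section
  -- their minimum.
  have key : ∀ x ∈ K, ∀ y ∈ K, x ⬝ᵥ n ≤ c → c ≤ y ⬝ᵥ n →
      min (x ⬝ᵥ v) (y ⬝ᵥ v) ≤ supportFun (K ∩ {x | x ⬝ᵥ n = c}) v := by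
    intro x hx y hy hxc hyc
    obtain ⟨t, ht0, ht1, ht⟩ := exists_combination_eq hxc hyc
    have hz : (1 - t) • x + t • y ∈ K ∩ {x | x ⬝ᵥ n = c} :=
      ⟨hK.convex hx hy (by linarith) ht0 (by ring), by
        rw [mem_ofPred_eq, add_dotProduct, smul_dotProduct, smul_dotProduct]; exact ht⟩
    have := h3.le_supportFun hz v
    simp only [add_dotProduct, smul_dotProduct, smul_eq_mul] at this
    refine le_trans ?_ this
    have ha := min_le_left (x ⬝ᵥ v) (y ⬝ᵥ v)
    have hb := min_le_right (x ⬝ᵥ v) (y ⬝ᵥ v)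
    nlinarith
  obtain ⟨x, hx, hxv⟩ := h1.exists_mem_supportFun v
  obtain ⟨y, hy, hyv⟩ := h2.exists_mem_supportFun v
  have hm := key x hx.1 y hy.1 hx.2 hy.2
  rw [hxv, hyv] at hm
  have hKm : supportFun K v = max (supportFun (K ∩ {x | x ⬝ᵥ n ≤ c}) v)
      (supportFun (K ∩ {x | c ≤ x ⬝ᵥ n}) v) := by
    refine le_antisymm (hK.supportFun_le fun z hz => ?_) (max_le
      (h1.supportFun_mono hK inter_subset_left v) (h2.supportFun_mono hK inter_subset_left v))
    rcases le_total (z ⬝ᵥ n) c with hc | hc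
    · exact le_max_of_le_left (h1.le_supportFun ⟨hz, hc⟩ v)
    · exact le_max_of_le_right (h2.le_supportFun ⟨hz, hc⟩ v)
  have h3m : supportFun (K ∩ {x | x ⬝ᵥ n = c}) v = min (supportFun (K ∩ {x | x ⬝ᵥ n ≤ c}) v)
      (supportFun (K ∩ {x | c ≤ x ⬝ᵥ n}) v) := by
    refine le_antisymm (le_min ?_ ?_) hm
    · exact h3.supportFun_mono h1 (fun z hz => ⟨hz.1, hz.2.le⟩) v
    · exact h3.supportFun_mono h2 (fun z hz => ⟨hz.1, hz.2.ge⟩) v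
  rw [hKm, h3m, max_add_min]

/-! ### Lattice polygons and their faces -/

/-- The convex hull of a finite set of lattice points. -/
def latticeHull (s : Finset (Fin 2 → ℤ)) : Set (Fin 2 → ℝ) :=
  convexHull ℝ (latticePt '' (s : Set (Fin 2 → ℤ)))

theorem latticePt_add (x y : Fin 2 → ℤ) : latticePt (x + y) = latticePt x + latticePt y := by
  ext i; simp [latticePt]

theorem latticePt_neg (x : Fin 2 → ℤ) : latticePt (-x) = -latticePt x := by
  ext i; simp [latticePt]

theorem latticePt_sub (x y : Fin 2 → ℤ) : latticePt (x - y) = latticePt x - latticePt y := by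
  ext i; simp [latticePt]

theorem latticePt_zero : latticePt 0 = 0 := by
  ext i; simp [latticePt]

theorem latticePt_nsmul (n : ℕ) (x : Fin 2 → ℤ) : latticePt (n • x) = (n : ℝ) • latticePt x := by
  ext i; simp [latticePt]

theorem latticePt_injective : Function.Injective latticePt := by
  intro x y h
  ext i
  have := congrFun h i
  simpa [latticePt] using this

theorem isLatticePolygon_latticeHull {s : Finset (Fin 2 → ℤ)} (hs : s.Nonempty) :
    IsLatticePolygon (latticeHull s) := ⟨s, hs, rfl⟩

theorem latticeHull_mono {s t : Finset (Fin 2 → ℤ)} (h : s ⊆ t) :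
    latticeHull s ⊆ latticeHull t :=
  convexHull_mono (image_mono (by exact_mod_cast h))

theorem latticePt_mem_latticeHull {s : Finset (Fin 2 → ℤ)} {p : Fin 2 → ℤ} (hp : p ∈ s) :
    latticePt p ∈ latticeHull s :=
  subset_convexHull ℝ _ ⟨p, hp, rfl⟩

theorem latticeHull_singleton (p : Fin 2 → ℤ) : latticeHull {p} = {latticePt p} := by
  simp [latticeHull]

theorem latticeHull_pair (p q : Fin 2 → ℤ) :
    latticeHull {p, q} = segment ℝ (latticePt p) (latticePt q) := by
  simp [latticeHull, image_pair, convexHull_pair]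

theorem latticeHull_add (s t : Finset (Fin 2 → ℤ)) :
    latticeHull s + latticeHull t = latticeHull (s + t) := by
  rw [latticeHull, latticeHull, latticeHull, ← convexHull_add]
  congr 1
  ext x
  simp only [Set.mem_add, mem_image, Finset.coe_add]
  constructor
  · rintro ⟨_, ⟨a, ha, rfl⟩, _, ⟨b, hb, rfl⟩, rfl⟩
    exact ⟨a + b, ⟨a, ha, b, hb, rfl⟩, latticePt_add a b⟩
  · rintro ⟨_, ⟨a, ha, b, hb, rfl⟩, rfl⟩
    exact ⟨_, ⟨a, ha, rfl⟩, _, ⟨b, hb, rfl⟩, (latticePt_add a b).symm⟩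

namespace IsLatticePolygon

variable {P Q : Set (Fin 2 → ℝ)}

theorem isBody (hP : IsLatticePolygon P) : IsBody P := by
  obtain ⟨s, hs, rfl⟩ := hP
  refine ⟨convex_convexHull ℝ _, (s.finite_toSet.image _).isCompact_convexHull (𝕜 := ℝ), ?_⟩
  exact (Set.Nonempty.image latticePt (s := (s : Set (Fin 2 → ℤ))) (by exact_mod_cast hs)).convexHull

theorem add (hP : IsLatticePolygon P) (hQ : IsLatticePolygon Q) : IsLatticePolygon (P + Q) := by
  obtain ⟨s, hs, rfl⟩ := hP
  obtain ⟨t, ht, rfl⟩ := hQ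
  exact ⟨s + t, hs.add ht, latticeHull_add s t⟩

/-- The maximum is attained at one of the generating lattice points. This integrality is what later
turns a strict inequality of support functions into a gap of at least one. -/
theorem exists_supportFun_eq (hP : IsLatticePolygon P) (v : Fin 2 → ℤ) :
    ∃ m : ℤ, supportFun P (latticePt v) = m := by
  have hB := hP.isBody
  obtain ⟨s, hs, rfl⟩ := hP
  obtain ⟨p, hp, hmax⟩ := s.exists_max_image (fun p => latticePt p ⬝ᵥ latticePt v) hs
  refine ⟨p 0 * v 0 + p 1 * v 1, ?_⟩
  have hpm : latticePt p ∈ latticeHull s := latticePt_mem_latticeHull hp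
  rw [hB.supportFun_eq hpm, dot_eq]
  · simp [latticePt]
  · intro y hy
    refine convexHull_min (t := {y | y ⬝ᵥ latticePt v ≤ latticePt p ⬝ᵥ latticePt v}) ?_ ?_ hy
    · rintro _ ⟨q, hq, rfl⟩
      exact hmax q hq
    · intro a ha b hb α β hα hβ hαβ
      simp only [mem_ofPred_eq, add_dotProduct, smul_dotProduct, smul_eq_mul] at *
      calc _ ≤ α * (latticePt p ⬝ᵥ latticePt v) + β * (latticePt p ⬝ᵥ latticePt v) := by gcongr
        _ = _ := by rw [← add_mul, hαβ, one_mul]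

end IsLatticePolygon

/-- The faces of a convex hull are the convex hulls of the extremal points. -/
theorem face_convexHull {S : Set (Fin 2 → ℝ)} {v : Fin 2 → ℝ} (hS : IsBody (convexHull ℝ S)) :
    face (convexHull ℝ S) v =
      convexHull ℝ {p | p ∈ S ∧ p ⬝ᵥ v = supportFun (convexHull ℝ S) v} := by
  set l := supportFun (convexHull ℝ S) v with hl
  set T := {p | p ∈ S ∧ p ⬝ᵥ v = l} with hT
  have hle : ∀ x ∈ convexHull ℝ S, x ⬝ᵥ v ≤ l := fun x hx => hS.le_supportFun hx v
  have hSU : S = T ∪ (S \ T) := (union_sdiff_cancel fun x hx => hx.1).symm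
  have hlt : ∀ x ∈ convexHull ℝ (S \ T), x ⬝ᵥ v < l := by
    intro x hx
    refine convexHull_min (t := {y | y ⬝ᵥ v < l}) ?_ ?_ hx
    · rintro y ⟨hy, hyT⟩
      exact lt_of_le_of_ne (hle y (subset_convexHull ℝ _ hy)) fun h => hyT ⟨hy, h⟩
    · exact convex_halfSpace_lt (isLinearMap_dot _) l
  have heq : ∀ x ∈ convexHull ℝ T, x ⬝ᵥ v = l := by
    intro x hx
    refine convexHull_min (t := {y | y ⬝ᵥ v = l}) (fun y hy => hy.2) ?_ hx
    exact convex_hyperplane (isLinearMap_dot _) l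
  ext x
  constructor
  · rintro ⟨hx, hxl⟩
    rw [← hl] at hxl
    rcases (S \ T).eq_empty_or_nonempty with he | hne
    · rwa [hSU, he, union_empty] at hx
    rcases T.eq_empty_or_nonempty with he | hTne
    · rw [he, sdiff_empty] at hlt
      exact absurd hxl (hlt x hx).ne
    rw [hSU, convexHull_union hTne hne, mem_convexJoin] at hx
    obtain ⟨y, hy, z, hz, a, b, ha, hb, hab, rfl⟩ := hx
    have h1 := heq y hy
    have h2 := hlt z hz
    rw [add_dotProduct, smul_dotProduct, smul_dotProduct, smul_eq_mul, smul_eq_mul, h1] at hxl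
    have hb0 : b = 0 := by
      by_contra hb0
      have h3 : b * (l - z ⬝ᵥ v) = 0 := by
        rw [show a = 1 - b by linarith] at hxl
        linarith
      exact (mul_pos (lt_of_le_of_ne hb (Ne.symm hb0)) (sub_pos.2 h2)).ne' h3
    have ha1 : a = 1 := by linarith
    simpa [hb0, ha1] using hy
  · intro hx
    exact ⟨convexHull_mono (fun y hy => hy.1) hx, heq x hx⟩

/-! ### Cut-additive functionals: reduction to segments and triangles -/

/-- A quantity that is additive when a lattice polygon is cut by a line into lattice polygons. -/
def CutAdditive (Φ : Set (Fin 2 → ℝ) → ℝ) : Prop :=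
  ∀ (K : Set (Fin 2 → ℝ)) (n : Fin 2 → ℝ) (c : ℝ), IsLatticePolygon K →
    IsLatticePolygon (K ∩ {x | x ⬝ᵥ n ≤ c}) → IsLatticePolygon (K ∩ {x | c ≤ x ⬝ᵥ n}) →
    IsLatticePolygon (K ∩ {x | x ⬝ᵥ n = c}) →
    Φ K + Φ (K ∩ {x | x ⬝ᵥ n = c}) = Φ (K ∩ {x | x ⬝ᵥ n ≤ c}) + Φ (K ∩ {x | c ≤ x ⬝ᵥ n})

/-- The part of a hull on one side of a line that meets the hull in the hull of points of `s`. -/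
theorem latticeHull_inter_halfplane {s : Finset (Fin 2 → ℤ)} {n : Fin 2 → ℝ} {c : ℝ}
    (hline : latticeHull s ∩ {x | x ⬝ᵥ n = c} ⊆
      latticeHull (s.filter fun p => latticePt p ⬝ᵥ n = c))
    (hne : (s.filter fun p => latticePt p ⬝ᵥ n = c).Nonempty) :
    latticeHull s ∩ {x | x ⬝ᵥ n ≤ c} = latticeHull (s.filter fun p => latticePt p ⬝ᵥ n ≤ c) := by
  have hlin : IsLinearMap ℝ fun y : Fin 2 → ℝ => y ⬝ᵥ n :=
    ⟨fun a b => add_dotProduct a b n, fun a b => smul_dotProduct a b n⟩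
  set s₁ := s.filter fun p => latticePt p ⬝ᵥ n ≤ c with hs₁
  set s₂ := s.filter fun p => c ≤ latticePt p ⬝ᵥ n with hs₂
  set s₀ := s.filter fun p => latticePt p ⬝ᵥ n = c with hs₀
  have h01 : s₀ ⊆ s₁ := fun p hp => by
    simp only [hs₀, hs₁, Finset.mem_filter] at *; exact ⟨hp.1, hp.2.le⟩
  have h02 : s₀ ⊆ s₂ := fun p hp => by
    simp only [hs₀, hs₂, Finset.mem_filter] at *; exact ⟨hp.1, hp.2.ge⟩
  have hle : ∀ x ∈ latticeHull s₁, x ⬝ᵥ n ≤ c := by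
    intro x hx
    refine convexHull_min (t := {y | y ⬝ᵥ n ≤ c}) ?_ (convex_halfSpace_le hlin c) hx
    rintro _ ⟨p, hp, rfl⟩
    exact (Finset.mem_filter.1 hp).2
  have hge : ∀ x ∈ latticeHull s₂, c ≤ x ⬝ᵥ n := by
    intro x hx
    refine convexHull_min (t := {y | c ≤ y ⬝ᵥ n}) ?_ (convex_halfSpace_ge hlin c) hx
    rintro _ ⟨p, hp, rfl⟩
    exact (Finset.mem_filter.1 hp).2
  refine subset_antisymm ?_ fun x hx =>
    ⟨latticeHull_mono (Finset.filter_subset _ _) hx, hle x hx⟩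
  rintro x ⟨hx, hxc⟩
  have hU : latticePt '' (s : Set (Fin 2 → ℤ)) = latticePt '' s₁ ∪ latticePt '' s₂ := by
    rw [← image_union]
    congr 1
    ext p
    simp only [hs₁, hs₂, mem_union, Finset.mem_coe, Finset.mem_filter, ← and_or_left]
    exact (and_iff_left (le_total _ _)).symm
  have hx0 := hx
  rw [latticeHull, hU, convexHull_union, mem_convexJoin] at hx
  rotate_left
  · exact (Set.Nonempty.image _ (by exact_mod_cast hne.mono h01))
  · exact (Set.Nonempty.image _ (by exact_mod_cast hne.mono h02))
  obtain ⟨y, hy, z, hz, a, b, ha, hb, hab, rfl⟩ := hx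
  have hy1 := hle y hy
  have hz1 := hge z hz
  rw [mem_ofPred_eq, add_dotProduct, smul_dotProduct, smul_dotProduct, smul_eq_mul,
    smul_eq_mul] at hxc
  have hconv : Convex ℝ (latticeHull s₁) := convex_convexHull ℝ _
  have hyK := latticeHull_mono (Finset.filter_subset _ _) hy
  have hzK := latticeHull_mono (Finset.filter_subset _ _) hz
  rcases eq_or_lt_of_le hz1 with hz2 | hz2
  · exact hconv hy (latticeHull_mono h01 (hline ⟨hzK, hz2.symm⟩)) ha hb hab
  set d := z ⬝ᵥ n - y ⬝ᵥ n with hd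
  have hd0 : 0 < d := by linarith
  -- The parameter at which the segment from `y` to `z` meets the line. The given point has
  -- parameter `b ≤ t`, so it lies between `y` and the crossing point, and both of these belong to
  -- the hull of `s₁`.
  set t := (c - y ⬝ᵥ n) / d with ht
  have htd : t * d = c - y ⬝ᵥ n := by rw [ht]; field_simp
  have ht0 : 0 ≤ t := div_nonneg (by linarith) hd0.le
  have ht1 : t ≤ 1 := (div_le_one hd0).2 (by linarith)
  have hbt : b ≤ t := by
    rw [ht, le_div_iff₀ hd0]
    have : a = 1 - b := by linarith
    rw [this] at hxc
    linarith
  have hr : (1 - t) • y + t • z ∈ latticeHull s₁ := by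
    refine latticeHull_mono h01 (hline ⟨?_, ?_⟩)
    · exact (convex_convexHull ℝ _) hyK hzK (by linarith) ht0 (by ring)
    · rw [mem_ofPred_eq, add_dotProduct, smul_dotProduct, smul_dotProduct, smul_eq_mul, smul_eq_mul]
      linarith
  rcases eq_or_lt_of_le ht0 with h0 | h0
  · have hb0 : b = 0 := by linarith
    have ha1 : a = 1 := by linarith
    rwa [hb0, ha1, one_smul, zero_smul, add_zero]
  · have := hconv hy hr (a := 1 - b / t) (b := b / t)
      (sub_nonneg.2 ((div_le_one h0).2 hbt)) (by positivity) (by ring)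
    convert! this using 1
    have ha' : a = 1 - b := by linarith
    rw [ha']
    ext i
    simp only [Pi.add_apply, Pi.smul_apply, smul_eq_mul]
    field_simp
    ring

theorem Convex.add_three_mem {K : Set (Fin 2 → ℝ)} (hK : Convex ℝ K) {x y z : Fin 2 → ℝ}
    (hx : x ∈ K) (hy : y ∈ K) (hz : z ∈ K) {α β γ : ℝ} (hα : 0 ≤ α) (hβ : 0 ≤ β) (hγ : 0 ≤ γ)
    (h : α + β + γ = 1) : α • x + β • y + γ • z ∈ K := by
  have := hK.sum_mem (t := Finset.univ) (w := ![α, β, γ]) (z := ![x, y, z])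
    (by intro i _; fin_cases i <;> assumption) (by simp [Fin.sum_univ_three, h])
    (by intro i _; fin_cases i <;> assumption)
  simpa [Fin.sum_univ_three] using this

theorem latticeHull_erase {s : Finset (Fin 2 → ℤ)} {p : Fin 2 → ℤ}
    (h : latticePt p ∈ latticeHull (s.erase p)) : latticeHull s = latticeHull (s.erase p) := by
  refine subset_antisymm (convexHull_min ?_ (convex_convexHull ℝ _))
    (latticeHull_mono (Finset.erase_subset _ _))
  rintro _ ⟨q, hq, rfl⟩
  by_cases hqp : q = p
  · rw [hqp]; exact h
  · exact latticePt_mem_latticeHull (Finset.mem_erase.2 ⟨hqp, hq⟩)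

/-- A point of `s` outside the hull of the others is no proper convex combination of another point
of `s` and a point of the hull. -/
theorem latticePt_ne_combination {s : Finset (Fin 2 → ℤ)} {a b : Fin 2 → ℤ}
    (ha : a ∈ s) (h : latticePt a ∉ latticeHull (s.erase a)) (hb : b ∈ s) (hab : b ≠ a)
    {x : Fin 2 → ℝ} (hx : x ∈ latticeHull s) {μ : ℝ} (h0 : 0 < μ) (h1 : μ ≤ 1) :
    latticePt a ≠ (1 - μ) • x + μ • latticePt b := by
  intro he
  have hb' : latticePt b ∈ latticeHull (s.erase a) :=
    latticePt_mem_latticeHull (Finset.mem_erase.2 ⟨hab, hb⟩)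
  have hins : latticePt '' (s : Set (Fin 2 → ℤ)) =
      insert (latticePt a) (latticePt '' (s.erase a : Finset (Fin 2 → ℤ))) := by
    rw [← image_insert_eq, ← Finset.coe_insert, Finset.insert_erase ha]
  rw [latticeHull, hins, convexHull_insert (Set.Nonempty.image _ ⟨b, Finset.mem_coe.2
    (Finset.mem_erase.2 ⟨hab, hb⟩)⟩), mem_convexJoin] at hx
  obtain ⟨a', ha', q, hq, c, u, hc, hu, hcu, rfl⟩ := hx
  rw [mem_singleton_iff.1 ha'] at he
  -- Substituting the decomposition of `x` and solving for `latticePt a` leaves `q` and `latticePt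
  -- b` with this total weight; dividing by it exhibits `latticePt a` in the hull of the other
  -- points.
  have hτ : 0 < (1 - μ) * u + μ := by
    have := mul_nonneg (sub_nonneg.2 h1) hu
    linarith
  apply h
  have hmem := (convex_convexHull ℝ _) hq hb' (a := (1 - μ) * u / ((1 - μ) * u + μ))
    (b := μ / ((1 - μ) * u + μ))
    (div_nonneg (mul_nonneg (sub_nonneg.2 h1) hu) hτ.le) (div_nonneg h0.le hτ.le)
    (by field_simp)
  convert! hmem using 1
  have hc' : c = 1 - u := by linarith
  rw [hc'] at he
  ext i
  have hei := congrFun he i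
  simp only [Pi.add_apply, Pi.smul_apply, smul_eq_mul] at hei ⊢
  field_simp
  linarith

theorem exists_eq_smul_of_dot_rot {e y : Fin 2 → ℝ} (he : e ≠ 0) (h : y ⬝ᵥ rot e = 0) :
    ∃ τ : ℝ, y = τ • e := by
  have hee := dot_self_pos he
  refine ⟨(y ⬝ᵥ e) / (e ⬝ᵥ e), ?_⟩
  rw [dot_eq] at hee
  simp only [dot_eq, rot, Matrix.cons_val_zero, Matrix.cons_val_one] at h ⊢
  refine plane_ext ?_ ?_ <;> simp only [Pi.smul_apply, smul_eq_mul] <;>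
    rw [div_mul_eq_mul_div, eq_div_iff hee.ne']
  · linear_combination e 1 * h
  · linear_combination (-e 0) * h

/-- For points in convex position, a line through two of them meets the hull only in the segment
between them: a point of the hull beyond one end would make that end a proper convex combination. -/
theorem latticeHull_inter_line_subset {s : Finset (Fin 2 → ℤ)}
    (hind : ∀ p ∈ s, latticePt p ∉ latticeHull (s.erase p)) {a b : Fin 2 → ℤ} (ha : a ∈ s)
    (hb : b ∈ s) (hab : a ≠ b) {x : Fin 2 → ℝ} (hx : x ∈ latticeHull s)
    (hxn : x ⬝ᵥ rot (latticePt b - latticePt a) =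
      latticePt a ⬝ᵥ rot (latticePt b - latticePt a)) : x ∈ latticeHull {a, b} := by
  have he0 : latticePt b - latticePt a ≠ 0 :=
    fun h => hab (latticePt_injective (sub_eq_zero.1 h).symm)
  obtain ⟨τ, hτ⟩ := exists_eq_smul_of_dot_rot (y := x - latticePt a) he0
    (by rw [sub_dotProduct, hxn, sub_self])
  have hx' : x = (1 - τ) • latticePt a + τ • latticePt b := by
    rw [eq_add_of_sub_eq hτ]
    module
  rcases lt_or_ge τ 0 with h0 | h0
  -- For `τ < 0` the point `a` lies between `x` and `b`; solving `x = (1 - τ) a + τ b` for `a` gives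
  -- the weight `-τ / (1 - τ)` of `b`. The case `τ > 1` is the same with the ends exchanged.
  · refine absurd ?_ (latticePt_ne_combination ha (hind a ha) hb hab.symm hx
      (μ := -τ / (1 - τ)) (div_pos (by linarith) (by linarith))
      ((div_le_one (by linarith)).2 (by linarith)))
    rw [hx']
    ext i
    simp only [Pi.add_apply, Pi.smul_apply, smul_eq_mul]
    have : 1 - τ ≠ 0 := by linarith
    field_simp
    ring
  rcases lt_or_ge 1 τ with h1 | h1
  · refine absurd ?_ (latticePt_ne_combination hb (hind b hb) ha hab hx
      (μ := (τ - 1) / τ) (div_pos (by linarith) (by linarith))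
      ((div_le_one (by linarith)).2 (by linarith)))
    rw [hx']
    ext i
    simp only [Pi.add_apply, Pi.smul_apply, smul_eq_mul]
    have : τ ≠ 0 := by linarith
    field_simp
    ring
  · rw [latticeHull_pair, hx']
    exact ⟨1 - τ, τ, by linarith, h0, by ring, rfl⟩

/-- The determinant of the triangle with the given vertices. -/
def triangleDet (x y z : Fin 2 → ℝ) : ℝ := cross (y - x) (z - x)

/-- The quotients of these determinants by the determinant of the triangle are the barycentric
coordinates of `w`. Products express their signs for either orientation of the triangle. -/
theorem mem_convexHull_of_triangleDet {K : Set (Fin 2 → ℝ)} (hK : Convex ℝ K)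
    {x y z w : Fin 2 → ℝ} (hx : x ∈ K) (hy : y ∈ K) (hz : z ∈ K) (hD : triangleDet x y z ≠ 0)
    (h1 : 0 ≤ triangleDet x y z * triangleDet x y w)
    (h2 : 0 ≤ triangleDet y z x * triangleDet y z w)
    (h3 : 0 ≤ triangleDet z x y * triangleDet z x w) : w ∈ K := by
  have e2 : triangleDet y z x = triangleDet x y z := by
    simp only [triangleDet, cross, Pi.sub_apply]; ring
  have e3 : triangleDet z x y = triangleDet x y z := by
    simp only [triangleDet, cross, Pi.sub_apply]; ring
  rw [e2] at h2
  rw [e3] at h3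
  have hq : ∀ t, 0 ≤ triangleDet x y z * t → 0 ≤ t / triangleDet x y z := by
    intro t ht
    rw [← mul_div_mul_left t _ hD]
    exact div_nonneg ht (mul_self_nonneg _)
  have := hK.add_three_mem hx hy hz (hq _ h2) (hq _ h3) (hq _ h1) (by
    field_simp
    simp only [triangleDet, cross, Pi.sub_apply]; ring)
  convert! this using 1
  refine plane_ext ?_ ?_ <;> simp only [Pi.add_apply, Pi.smul_apply, smul_eq_mul] <;>
    field_simp <;> simp only [triangleDet, cross, Pi.sub_apply] <;> ring

theorem exists_wbtw_of_cross_eq_zero {x y z : Fin 2 → ℝ} (h : triangleDet x y z = 0) :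
    z ∈ segment ℝ x y ∨ x ∈ segment ℝ y z ∨ y ∈ segment ℝ z x := by
  have hc : Collinear ℝ {x, y, z} := by
    rcases eq_or_ne y x with rfl | hyx
    · simpa using collinear_pair ℝ y z
    obtain ⟨τ, hτ⟩ := exists_eq_smul_of_dot_rot (e := y - x) (y := z - x) (sub_ne_zero.2 hyx) (by
      simp only [triangleDet, cross, Pi.sub_apply, dot_eq, rot, Matrix.cons_val_zero,
        Matrix.cons_val_one] at h ⊢
      linarith)
    rw [collinear_iff_of_mem (p₀ := x) (by simp)]
    refine ⟨y - x, ?_⟩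
    rintro p (rfl | rfl | rfl)
    · exact ⟨0, by simp⟩
    · exact ⟨1, by simp⟩
    · exact ⟨τ, by rw [← hτ]; simp⟩
  rcases hc.wbtw_or_wbtw_or_wbtw with h | h | h
  · exact Or.inr (Or.inr (segment_symm ℝ x z ▸ mem_segment_iff_wbtw.2 h))
  · exact Or.inl (segment_symm ℝ y x ▸ mem_segment_iff_wbtw.2 h)
  · exact Or.inr (Or.inl (segment_symm ℝ z y ▸ mem_segment_iff_wbtw.2 h))

theorem CutAdditive.eq_zero {Φ : Set (Fin 2 → ℝ) → ℝ} (hΦ : CutAdditive Φ)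
    (h2 : ∀ p q, Φ (latticeHull {p, q}) = 0)
    (h3 : ∀ p q r, 0 < triangleDet (latticePt p) (latticePt q) (latticePt r) →
      Φ (latticeHull {p, q, r}) = 0)
    {P : Set (Fin 2 → ℝ)} (hP : IsLatticePolygon P) : Φ P = 0 := by
  obtain ⟨s, hs, rfl⟩ := hP
  change Φ (latticeHull s) = 0
  induction hk : s.card using Nat.strong_induction_on generalizing s with
  | _ k ih =>
  subst hk
  by_cases hex : ∃ p ∈ s, latticePt p ∈ latticeHull (s.erase p)
  · obtain ⟨p, hp, hmem⟩ := hex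
    rw [latticeHull_erase hmem]
    refine ih _ (Finset.card_erase_lt_of_mem hp) _ ?_ rfl
    rw [Finset.nonempty_iff_ne_empty]
    intro he
    rw [he] at hmem
    simp [latticeHull] at hmem
  push Not at hex
  have hndet : ∀ a ∈ s, ∀ b ∈ s, ∀ c ∈ s, a ≠ b → b ≠ c → c ≠ a →
      triangleDet (latticePt a) (latticePt b) (latticePt c) ≠ 0 := by
    intro a ha b hb c hc hab hbc hca h
    have hsub : ∀ x ∈ s, ∀ y ∈ s, ∀ z, x ≠ z → y ≠ z →
        segment ℝ (latticePt x) (latticePt y) ⊆ latticeHull (s.erase z) := by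
      intro x hx y hy z hxz hyz
      exact (convex_convexHull ℝ _).segment_subset
        (latticePt_mem_latticeHull (Finset.mem_erase.2 ⟨hxz, hx⟩))
        (latticePt_mem_latticeHull (Finset.mem_erase.2 ⟨hyz, hy⟩))
    rcases exists_wbtw_of_cross_eq_zero h with h | h | h
    · exact hex c hc (hsub a ha b hb c hca.symm hbc h)
    · exact hex a ha (hsub b hb c hc a hab.symm hca h)
    · exact hex b hb (hsub c hc a ha b hbc.symm hab h)
  rcases lt_or_ge s.card 4 with hlt | hge
  · have hpos := hs.card_pos
    have hcases : s.card = 1 ∨ s.card = 2 ∨ s.card = 3 := by omega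
    rcases hcases with h | h | h
    · obtain ⟨p, rfl⟩ := Finset.card_eq_one.1 h
      simpa using h2 p p
    · obtain ⟨p, q, -, rfl⟩ := Finset.card_eq_two.1 h
      exact h2 p q
    · obtain ⟨p, q, r, hpq, hpr, hqr, rfl⟩ := Finset.card_eq_three.1 h
      rcases (hndet p (by simp) q (by simp) r (by simp) hpq hqr hpr.symm).lt_or_gt with h | h
      · rw [Finset.pair_comm q r]
        refine h3 p r q ?_
        simp only [triangleDet, cross, Pi.sub_apply] at h ⊢
        linarith
      · exact h3 p q r h
  -- If no line through two points separated two others, a fourth point would lie on the inner side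
  -- of all three sides of the triangle formed by three points, hence in that triangle, against
  -- convex position.
  obtain ⟨a, ha, b, hb, c, hc, d, hd, hab, hsep⟩ : ∃ a ∈ s, ∃ b ∈ s, ∃ c ∈ s, ∃ d ∈ s, a ≠ b ∧
      triangleDet (latticePt a) (latticePt b) (latticePt c) *
        triangleDet (latticePt a) (latticePt b) (latticePt d) < 0 := by
    obtain ⟨t, hts, ht⟩ := Finset.exists_subset_card_eq (show 3 ≤ s.card by omega)
    obtain ⟨d, hd, hdt⟩ := Finset.exists_mem_notMem_of_card_lt_card (show t.card < s.card by omega)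
    obtain ⟨a, b, c, hab, hac, hbc, rfl⟩ := Finset.card_eq_three.1 ht
    have ha : a ∈ s := hts (by simp)
    have hb : b ∈ s := hts (by simp)
    have hc : c ∈ s := hts (by simp)
    simp only [Finset.mem_insert, Finset.mem_singleton, not_or] at hdt
    by_contra hcon
    push Not at hcon
    refine hex d hd (mem_convexHull_of_triangleDet (convex_convexHull ℝ _)
      (latticePt_mem_latticeHull (Finset.mem_erase.2 ⟨Ne.symm hdt.1, ha⟩))
      (latticePt_mem_latticeHull (Finset.mem_erase.2 ⟨Ne.symm hdt.2.1, hb⟩))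
      (latticePt_mem_latticeHull (Finset.mem_erase.2 ⟨Ne.symm hdt.2.2, hc⟩))
      (hndet a ha b hb c hc hab hbc hac.symm)
      (hcon a ha b hb c hc d hd hab) (hcon b hb c hc a ha d hd hbc)
      (hcon c hc a ha b hb d hd hac.symm))
  set n := rot (latticePt b - latticePt a) with hn
  set k := latticePt a ⬝ᵥ n with hk
  have hdet : ∀ x, triangleDet (latticePt a) (latticePt b) x = k - x ⬝ᵥ n := by
    intro x
    simp only [hk, hn, triangleDet, cross, Pi.sub_apply, dot_eq, rot, Matrix.cons_val_zero,
      Matrix.cons_val_one]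
    ring
  have hbk : latticePt b ⬝ᵥ n = k := by
    simp only [hk, hn, dot_eq, rot, Matrix.cons_val_zero, Matrix.cons_val_one, Pi.sub_apply]
    ring
  rw [hdet, hdet] at hsep
  have hline : latticeHull s ∩ {x | x ⬝ᵥ n = k} ⊆
      latticeHull (s.filter fun p => latticePt p ⬝ᵥ n = k) := by
    rintro x ⟨hx, hxk⟩
    refine latticeHull_mono ?_ (latticeHull_inter_line_subset hex ha hb hab hx hxk)
    intro p hp
    rw [Finset.mem_filter]
    rcases Finset.mem_insert.1 hp with rfl | hp
    · exact ⟨ha, rfl⟩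
    · rw [Finset.mem_singleton.1 hp]
      exact ⟨hb, hbk⟩
  have hne : (s.filter fun p => latticePt p ⬝ᵥ n = k).Nonempty :=
    ⟨a, Finset.mem_filter.2 ⟨ha, rfl⟩⟩
  have e1 := latticeHull_inter_halfplane hline hne
  have e2 : latticeHull s ∩ {x | k ≤ x ⬝ᵥ n} =
      latticeHull (s.filter fun p => k ≤ latticePt p ⬝ᵥ n) := by
    have := latticeHull_inter_halfplane (s := s) (n := -n) (c := -k)
    simp only [dotProduct_neg, neg_inj, neg_le_neg_iff] at this
    exact this hline hne
  have e3 : latticeHull s ∩ {x | x ⬝ᵥ n = k} =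
      latticeHull (s.filter fun p => latticePt p ⬝ᵥ n = k) := by
    refine subset_antisymm hline fun x hx => ⟨latticeHull_mono (Finset.filter_subset _ _) hx, ?_⟩
    refine convexHull_min (t := {y | y ⬝ᵥ n = k}) ?_ ?_ hx
    · rintro _ ⟨p, hp, rfl⟩
      exact (Finset.mem_filter.1 hp).2
    · exact convex_hyperplane (isLinearMap_dot _) k
  obtain ⟨u, hu, huk, w, hw, hwk⟩ : ∃ u ∈ s, latticePt u ⬝ᵥ n < k ∧
      ∃ w ∈ s, k < latticePt w ⬝ᵥ n := by
    rcases mul_neg_iff.1 hsep with ⟨h, h'⟩ | ⟨h, h'⟩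
    · exact ⟨c, hc, by linarith, d, hd, by linarith⟩
    · exact ⟨d, hd, by linarith, c, hc, by linarith⟩
  have hne1 := hne.mono (show _ ⊆ s.filter fun p => latticePt p ⬝ᵥ n ≤ k from
    Finset.monotone_filter_right s fun p _ h => le_of_eq h)
  have hne2 := hne.mono (show _ ⊆ s.filter fun p => k ≤ latticePt p ⬝ᵥ n from
    Finset.monotone_filter_right s fun p _ h => ge_of_eq h)
  have hcut := hΦ (latticeHull s) n k (isLatticePolygon_latticeHull hs)
    (e1 ▸ isLatticePolygon_latticeHull hne1) (e2 ▸ isLatticePolygon_latticeHull hne2)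
    (e3 ▸ isLatticePolygon_latticeHull hne)
  rw [e1, e2, e3, ih _ ?_ _ hne rfl, ih _ ?_ _ hne1 rfl, ih _ ?_ _ hne2 rfl] at hcut
  · simpa using hcut
  · exact Finset.card_lt_card (Finset.filter_ssubset.2 ⟨u, hu, huk.not_ge⟩)
  · exact Finset.card_lt_card (Finset.filter_ssubset.2 ⟨w, hw, hwk.not_ge⟩)
  · exact Finset.card_lt_card (Finset.filter_ssubset.2 ⟨u, hu, huk.ne⟩)

/-! ### Faces and edge lengths -/

theorem IsBody.face {K : Set (Fin 2 → ℝ)} (hK : IsBody K) (v : Fin 2 → ℝ) : IsBody (face K v) := by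
  have hcl : IsClosed {u : Fin 2 → ℝ | u ⬝ᵥ v = supportFun K v} :=
    isClosed_eq (continuous_dot v) continuous_const
  refine ⟨?_, hK.compact.inter_right hcl, hK.exists_mem_supportFun v⟩
  exact hK.convex.inter (convex_hyperplane (isLinearMap_dot _) _)

/-- The support function of a lattice polygon is affine along rays far out. -/
theorem IsLatticePolygon.eventually_supportFun_eq {P : Set (Fin 2 → ℝ)} (hP : IsLatticePolygon P)
    (v w : Fin 2 → ℝ) : ∀ᶠ N : ℕ in atTop,
      supportFun P ((N : ℝ) • v + w) = N * supportFun P v + supportFun (face P v) w := by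
  have hB := hP.isBody
  have hF := hB.face v
  obtain ⟨s, hs, rfl⟩ := hP
  change IsBody (latticeHull s) at hB
  change ∀ᶠ N : ℕ in atTop, supportFun (latticeHull s) ((N : ℝ) • v + w) =
    N * supportFun (latticeHull s) v + supportFun (_root_.face (latticeHull s) v) w
  change IsBody (_root_.face (latticeHull s) v) at hF
  set l := supportFun (latticeHull s) v with hl
  set m := supportFun (_root_.face (latticeHull s) v) w with hm
  have hq : ∀ q ∈ s, ∀ᶠ N : ℕ in atTop, latticePt q ⬝ᵥ ((N : ℝ) • v + w) ≤ N * l + m := by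
    intro q hq
    have hqP := latticePt_mem_latticeHull hq
    rcases eq_or_lt_of_le (hB.le_supportFun hqP v) with h | h
    · refine Eventually.of_forall fun N => ?_
      have := hF.le_supportFun (x := latticePt q) ⟨hqP, h⟩ w
      rw [dotProduct_add, dotProduct_smul, smul_eq_mul, h]
      linarith
    -- A point off the face loses an amount growing linearly in `N`, which finally outweighs any
    -- advantage in direction `w`.
    · have ht : Tendsto (fun N : ℕ => (N : ℝ) * (l - latticePt q ⬝ᵥ v)) atTop atTop :=
        tendsto_natCast_atTop_atTop.atTop_mul_const (by rw [hl]; linarith)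
      filter_upwards [ht.eventually_ge_atTop (latticePt q ⬝ᵥ w - m)] with N hN
      rw [dotProduct_add, dotProduct_smul, smul_eq_mul]
      linarith
  filter_upwards [(Finset.eventually_all s).2 hq] with N hN
  refine le_antisymm (hB.supportFun_le fun x hx => ?_) ?_
  · refine convexHull_min (t := {y | y ⬝ᵥ ((N : ℝ) • v + w) ≤ N * l + m}) ?_ ?_ hx
    · rintro _ ⟨q, hq, rfl⟩
      exact hN q hq
    · exact convex_halfSpace_le (isLinearMap_dot _) _
  · obtain ⟨u, hu, huw⟩ := hF.exists_mem_supportFun w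
    have := hB.le_supportFun hu.1 ((N : ℝ) • v + w)
    rwa [dotProduct_add, dotProduct_smul, smul_eq_mul, hu.2, huw] at this

/-- The length of the face of `P` with outer normal `v`, in multiples of the length of `v`. -/
noncomputable def edgeLength (P : Set (Fin 2 → ℝ)) (v : Fin 2 → ℝ) : ℝ :=
  (supportFun (face P v) (rot v) + supportFun (face P v) (-rot v)) / (v ⬝ᵥ v)

/-- A linear relation between support functions passes to faces: evaluated at `N v + w` for one
large `N`, its terms proportional to `N` cancel, and the support functions of the faces at `w`
remain. -/
theorem edgeLength_add_eq_add {K₁ K₂ K₃ K₄ : Set (Fin 2 → ℝ)} (h₁ : IsLatticePolygon K₁)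
    (h₂ : IsLatticePolygon K₂) (h₃ : IsLatticePolygon K₃) (h₄ : IsLatticePolygon K₄)
    (h : ∀ v, supportFun K₁ v + supportFun K₂ v = supportFun K₃ v + supportFun K₄ v)
    (v : Fin 2 → ℝ) :
    edgeLength K₁ v + edgeLength K₂ v = edgeLength K₃ v + edgeLength K₄ v := by
  have key : ∀ w, supportFun (face K₁ v) w + supportFun (face K₂ v) w =
      supportFun (face K₃ v) w + supportFun (face K₄ v) w := by
    intro w
    obtain ⟨N, ⟨⟨e1, e2⟩, e3⟩, e4⟩ := (((h₁.eventually_supportFun_eq v w).and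
      (h₂.eventually_supportFun_eq v w)).and (h₃.eventually_supportFun_eq v w)).and
      (h₄.eventually_supportFun_eq v w) |>.exists
    have e := h ((N : ℝ) • v + w)
    rw [e1, e2, e3, e4] at e
    linear_combination e - (N : ℝ) * h v
  simp only [edgeLength]
  rw [← add_div, ← add_div]
  congr 1
  linear_combination key (rot v) + key (-rot v)

theorem rot_rot (v : Fin 2 → ℝ) : rot (rot v) = -v := by
  refine plane_ext ?_ ?_ <;> simp [rot]

theorem dot_rot_self (v : Fin 2 → ℝ) : v ⬝ᵥ rot v = 0 := by
  rw [dot_eq]; simp [rot]; ring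

theorem rot_dot_rot (v w : Fin 2 → ℝ) : rot v ⬝ᵥ rot w = v ⬝ᵥ w := by
  rw [dot_eq, dot_eq]; simp [rot]; ring

theorem rot_neg (v : Fin 2 → ℝ) : rot (-v) = -rot v := by
  refine plane_ext ?_ ?_ <;> simp [rot]

theorem rot_smul (c : ℝ) (v : Fin 2 → ℝ) : rot (c • v) = c • rot v := by
  refine plane_ext ?_ ?_ <;> simp [rot]

theorem rot_ne_zero {v : Fin 2 → ℝ} (hv : v ≠ 0) : rot v ≠ 0 := by
  intro h
  have := dot_self_pos hv
  rw [← rot_dot_rot, h] at this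
  simp at this

theorem latticePt_ne_zero {v : Fin 2 → ℤ} (hv : IsCoprime (v 0) (v 1)) : latticePt v ≠ 0 := by
  intro h
  rw [← latticePt_zero] at h
  rw [latticePt_injective h] at hv
  exact not_isCoprime_zero_zero hv

theorem isBody_segment (x y : Fin 2 → ℝ) : IsBody (segment ℝ x y) := by
  refine ⟨convex_segment x y, ?_, ⟨x, left_mem_segment ℝ x y⟩⟩
  rw [segment_eq_image_lineMap]
  exact isCompact_Icc.image AffineMap.lineMap_continuous

theorem supportFun_segment (x y v : Fin 2 → ℝ) :
    supportFun (segment ℝ x y) v = max (x ⬝ᵥ v) (y ⬝ᵥ v) := by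
  have hB := isBody_segment x y
  refine le_antisymm (hB.supportFun_le ?_) (max_le (hB.le_supportFun (left_mem_segment ℝ x y) v)
    (hB.le_supportFun (right_mem_segment ℝ x y) v))
  rintro _ ⟨a, b, ha, hb, hab, rfl⟩
  rw [add_dotProduct, smul_dotProduct, smul_dotProduct, smul_eq_mul, smul_eq_mul]
  calc _ ≤ a * max (x ⬝ᵥ v) (y ⬝ᵥ v) + b * max (x ⬝ᵥ v) (y ⬝ᵥ v) := by
        gcongr
        · exact le_max_left _ _
        · exact le_max_right _ _
    _ = _ := by rw [← add_mul, hab, one_mul]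

theorem edgeLength_of_face_eq_segment {P : Set (Fin 2 → ℝ)} {x y v : Fin 2 → ℝ} (hv : v ≠ 0)
    {d : ℝ} (hd : 0 ≤ d) (hf : face P v = segment ℝ x y) (h : rot (y - x) = d • v) :
    edgeLength P v = d := by
  have hvv := dot_self_pos hv
  have hy : y - x = -(d • rot v) := by
    rw [← rot_smul, ← h, rot_rot, neg_neg]
  have e : (y - x) ⬝ᵥ rot v = -(d * (v ⬝ᵥ v)) := by
    rw [hy, neg_dotProduct, smul_dotProduct, rot_dot_rot, smul_eq_mul]
  rw [sub_dotProduct] at e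
  have hdv := mul_nonneg hd hvv.le
  rw [edgeLength, hf, supportFun_segment, supportFun_segment, dotProduct_neg, dotProduct_neg,
    max_eq_left (by linarith), max_eq_right (by linarith), div_eq_iff hvv.ne']
  linarith

namespace IsBody

variable {P : Set (Fin 2 → ℝ)}

theorem edgeLength_pos (hP : IsBody P) {v : Fin 2 → ℝ} (hv : v ≠ 0)
    (h : (_root_.face P v).Nontrivial) : 0 < edgeLength P v := by
  obtain ⟨x, hx, y, hy, hxy⟩ := h
  refine div_pos ?_ (dot_self_pos hv)
  have h1 : (x - y) ⬝ᵥ rot (rot v) = 0 := by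
    rw [rot_rot, dotProduct_neg, sub_dotProduct, hx.2, hy.2, sub_self, neg_zero]
  obtain ⟨c, hc⟩ := exists_eq_smul_of_dot_rot (rot_ne_zero hv) h1
  have hF := hP.face v
  have hpos := dot_self_pos (rot_ne_zero hv)
  have e : x ⬝ᵥ rot v - y ⬝ᵥ rot v = c * (rot v ⬝ᵥ rot v) := by
    rw [← sub_dotProduct, hc, smul_dotProduct, smul_eq_mul]
  have hc0 : c ≠ 0 := by
    rintro rfl
    exact hxy (sub_eq_zero.1 (by simpa using hc))
  have a1 := hF.le_supportFun hx (rot v)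
  have a2 := hF.le_supportFun hx (-rot v)
  have a3 := hF.le_supportFun hy (rot v)
  have a4 := hF.le_supportFun hy (-rot v)
  rw [dotProduct_neg] at a2 a4
  rcases hc0.lt_or_gt with h | h
  · have := mul_neg_of_neg_of_pos h hpos
    linarith
  · have := mul_pos h hpos
    linarith

theorem edgeLength_eq_zero (hP : IsBody P) {v : Fin 2 → ℝ}
    (h : ¬ (_root_.face P v).Nontrivial) : edgeLength P v = 0 := by
  obtain ⟨x, hx⟩ := (hP.face v).nonempty
  have : _root_.face P v = {x} := (not_nontrivial_iff.1 h).eq_singleton_of_mem hx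
  rw [edgeLength, this, supportFun_singleton, supportFun_singleton, dotProduct_neg,
    add_neg_cancel, zero_div]

theorem edgeLength_nonneg (hP : IsBody P) {v : Fin 2 → ℝ} (hv : v ≠ 0) : 0 ≤ edgeLength P v := by
  by_cases h : (_root_.face P v).Nontrivial
  · exact (hP.edgeLength_pos hv h).le
  · exact (hP.edgeLength_eq_zero h).ge

end IsBody

/-! ### The fan and weighted edge sums -/

/-- A direction in the fan of a hull is normal to the difference of two extremal vertices. -/
theorem exists_of_mem_fan {s : Finset (Fin 2 → ℤ)} (hs : s.Nonempty) {v : Fin 2 → ℤ}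
    (hv : v ∈ fan (latticeHull s)) : ∃ p ∈ s, ∃ q ∈ s, p ≠ q ∧
      latticePt p ⬝ᵥ latticePt v = supportFun (latticeHull s) (latticePt v) ∧
      latticePt q ⬝ᵥ latticePt v = supportFun (latticeHull s) (latticePt v) := by
  have hB : IsBody (latticeHull s) := (isLatticePolygon_latticeHull hs).isBody
  have h := hv.2
  rw [latticeHull, face_convexHull hB] at h
  have hnt : {p | p ∈ latticePt '' (s : Set (Fin 2 → ℤ)) ∧
      p ⬝ᵥ latticePt v = supportFun (latticeHull s) (latticePt v)}.Nontrivial := by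
    by_contra hn
    rcases (not_nontrivial_iff.1 hn).eq_empty_or_singleton with he | ⟨x, he⟩
    · rw [← latticeHull, he, convexHull_empty] at h
      exact not_nontrivial_empty h
    · rw [← latticeHull, he, convexHull_singleton] at h
      exact not_nontrivial_singleton h
  obtain ⟨_, ⟨⟨p, hp, rfl⟩, hpl⟩, _, ⟨⟨q, hq, rfl⟩, hql⟩, hpq⟩ := hnt
  exact ⟨p, hp, q, hq, fun h => hpq (by rw [h]), hpl, hql⟩

/-- A lattice vector orthogonal to a primitive vector `v` is a multiple of the rotated `v`. -/
theorem exists_rot_eq_zsmul {v e : Fin 2 → ℤ} (hv : IsCoprime (v 0) (v 1))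
    (h : e 0 * v 0 + e 1 * v 1 = 0) : ∃ k : ℤ, e 1 = k * v 0 ∧ -e 0 = k * v 1 := by
  obtain ⟨a, b, hab⟩ := hv
  refine ⟨a * e 1 - b * e 0, ?_, ?_⟩
  · linear_combination (-(e 1)) * hab + b * h
  · linear_combination (e 0) * hab - a * h

theorem dot_latticePt (x y : Fin 2 → ℤ) :
    latticePt x ⬝ᵥ latticePt y = ((x 0 * y 0 + x 1 * y 1 : ℤ) : ℝ) := by
  rw [dot_eq]; simp [latticePt]

theorem exists_rot_sub_eq_smul {v p q : Fin 2 → ℤ} (hv : IsCoprime (v 0) (v 1))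
    (hpq : p ≠ q) (h : latticePt p ⬝ᵥ latticePt v = latticePt q ⬝ᵥ latticePt v) :
    ∃ k : ℤ, k ≠ 0 ∧ (q - p) 1 = k * v 0 ∧ -(q - p) 0 = k * v 1 := by
  rw [dot_latticePt, dot_latticePt] at h
  have h' : p 0 * v 0 + p 1 * v 1 = q 0 * v 0 + q 1 * v 1 := by exact_mod_cast h
  obtain ⟨k, h1, h2⟩ := exists_rot_eq_zsmul (e := q - p) hv (by
    simp only [Pi.sub_apply]; linarith)
  refine ⟨k, ?_, h1, h2⟩
  rintro rfl
  apply hpq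
  simp only [Pi.sub_apply, zero_mul] at h1 h2
  ext i
  fin_cases i
  · exact (by linarith : p 0 = q 0)
  · exact (by linarith : p 1 = q 1)

/-- The rotated difference of two generating points on the edge is a nonzero integer multiple of
`v`, so the coordinates of `v` are bounded by those of finitely many differences. -/
theorem IsLatticePolygon.finite_fan {P : Set (Fin 2 → ℝ)} (hP : IsLatticePolygon P) :
    (fan P).Finite := by
  obtain ⟨s, hs, rfl⟩ := hP
  have hfin : (⋃ p ∈ s, ⋃ q ∈ s, Icc (![-|(q - p) 1|, -|(q - p) 0|] : Fin 2 → ℤ)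
      ![|(q - p) 1|, |(q - p) 0|]).Finite :=
    s.finite_toSet.biUnion fun p _ => s.finite_toSet.biUnion fun q _ => finite_Icc _ _
  refine hfin.subset fun v hv => ?_
  obtain ⟨p, hp, q, hq, hpq, h1, h2⟩ := exists_of_mem_fan hs hv
  obtain ⟨k, hk, e1, e2⟩ := exists_rot_sub_eq_smul hv.1 hpq (h1.trans h2.symm)
  simp only [mem_iUnion]
  refine ⟨p, hp, q, hq, ?_⟩
  have hk1 : 1 ≤ |k| := Int.one_le_abs hk
  have b0 : |v 0| ≤ |(q - p) 1| := by
    rw [e1, abs_mul]; exact le_mul_of_one_le_left (abs_nonneg _) hk1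
  have b1 : |v 1| ≤ |(q - p) 0| := by
    rw [← abs_neg ((q - p) 0), e2, abs_mul]; exact le_mul_of_one_le_left (abs_nonneg _) hk1
  rw [abs_le] at b0 b1
  constructor <;> intro i <;> fin_cases i
  · exact b0.1
  · exact b1.1
  · exact b0.2
  · exact b1.2

/-- The sum of `φ` over the outer normals of the edges of `P`, weighted by lattice length. -/
noncomputable def edgeSum (P : Set (Fin 2 → ℝ)) (φ : (Fin 2 → ℝ) → ℝ) : ℝ :=
  ∑ᶠ v ∈ {v : Fin 2 → ℤ | IsCoprime (v 0) (v 1)}, edgeLength P (latticePt v) * φ (latticePt v)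

/-- Directions outside the fan have edge length zero, so any finite set of primitive vectors
containing the fan may be summed over. This allows one index set for several polygons. -/
theorem edgeSum_eq_sum {P : Set (Fin 2 → ℝ)} (hP : IsBody P) {F : Finset (Fin 2 → ℤ)}
    (h1 : fan P ⊆ F) (h2 : ∀ v ∈ F, IsCoprime (v 0) (v 1)) (φ : (Fin 2 → ℝ) → ℝ) :
    edgeSum P φ = ∑ v ∈ F, edgeLength P (latticePt v) * φ (latticePt v) := by
  refine finsum_mem_eq_sum_of_subset _ ?_ h2
  rintro v ⟨hv, hvs⟩
  refine h1 ⟨hv, ?_⟩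
  by_contra hn
  exact hvs (by simp [hP.edgeLength_eq_zero hn])

theorem edgeSum_add_eq_add {K₁ K₂ K₃ K₄ : Set (Fin 2 → ℝ)} (h₁ : IsLatticePolygon K₁)
    (h₂ : IsLatticePolygon K₂) (h₃ : IsLatticePolygon K₃) (h₄ : IsLatticePolygon K₄)
    (h : ∀ v, supportFun K₁ v + supportFun K₂ v = supportFun K₃ v + supportFun K₄ v)
    (φ : (Fin 2 → ℝ) → ℝ) :
    edgeSum K₁ φ + edgeSum K₂ φ = edgeSum K₃ φ + edgeSum K₄ φ := by
  classical
  set F := h₁.finite_fan.toFinset ∪ h₂.finite_fan.toFinset ∪ h₃.finite_fan.toFinset ∪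
    h₄.finite_fan.toFinset with hF
  have hF2 : ∀ v ∈ F, IsCoprime (v 0) (v 1) := by
    intro v hv
    simp only [hF, Finset.mem_union, Finite.mem_toFinset] at hv
    rcases hv with ((hv | hv) | hv) | hv <;> exact hv.1
  have hsub : ∀ {x}, x ∈ fan K₁ ∨ x ∈ fan K₂ ∨ x ∈ fan K₃ ∨ x ∈ fan K₄ → x ∈ (F : Set _) := by
    intro x hx
    simp only [hF, Finset.mem_coe, Finset.mem_union, Finite.mem_toFinset]
    tauto
  rw [edgeSum_eq_sum h₁.isBody (F := F) (fun x hx => hsub (by tauto)) hF2,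
    edgeSum_eq_sum h₂.isBody (F := F) (fun x hx => hsub (by tauto)) hF2,
    edgeSum_eq_sum h₃.isBody (F := F) (fun x hx => hsub (by tauto)) hF2,
    edgeSum_eq_sum h₄.isBody (F := F) (fun x hx => hsub (by tauto)) hF2,
    ← Finset.sum_add_distrib, ← Finset.sum_add_distrib]
  refine Finset.sum_congr rfl fun v _ => ?_
  rw [← add_mul, ← add_mul, edgeLength_add_eq_add h₁ h₂ h₃ h₄ h]

theorem edgeSum_cutAdditive (φ : (Fin 2 → ℝ) → ℝ) : CutAdditive fun K => edgeSum K φ :=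
  fun _ _ _ hK h1 h2 h3 => edgeSum_add_eq_add hK h3 h1 h2
    (supportFun_cut hK.isBody h1.isBody h2.isBody h3.isBody) φ

namespace IsLatticePolygon

variable {P Q : Set (Fin 2 → ℝ)}

theorem singleton (p : Fin 2 → ℤ) : IsLatticePolygon {latticePt p} :=
  ⟨{p}, Finset.singleton_nonempty p, (latticeHull_singleton p).symm⟩

theorem edgeSum_singleton (p : Fin 2 → ℝ) (φ : (Fin 2 → ℝ) → ℝ) : edgeSum {p} φ = 0 := by
  rw [edgeSum_eq_sum (IsBody.singleton p) (F := ∅) ?_ (by simp)]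
  · simp
  · rintro v ⟨-, hv⟩
    exact absurd (hv.mono fun x hx => hx.1) not_nontrivial_singleton

theorem edgeSum_add (hP : IsLatticePolygon P) (hQ : IsLatticePolygon Q)
    (φ : (Fin 2 → ℝ) → ℝ) : edgeSum (P + Q) φ = edgeSum P φ + edgeSum Q φ := by
  have := edgeSum_add_eq_add (hP.add hQ) (IsLatticePolygon.singleton 0) hP hQ (fun v => by
    rw [hP.isBody.supportFun_add hQ.isBody, IsBody.supportFun_singleton, latticePt_zero,
      zero_dotProduct, add_zero]) φ
  rwa [edgeSum_singleton, add_zero] at this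

theorem edgeSum_add_right (hP : IsLatticePolygon P) (φ ψ : (Fin 2 → ℝ) → ℝ) :
    edgeSum P (fun v => φ v + ψ v) = edgeSum P φ + edgeSum P ψ := by
  have h1 : fan P ⊆ (hP.finite_fan.toFinset : Set (Fin 2 → ℤ)) := by simp
  have h2 : ∀ v ∈ hP.finite_fan.toFinset, IsCoprime (v 0) (v 1) := fun v hv => by
    rw [Finite.mem_toFinset] at hv; exact hv.1
  rw [edgeSum_eq_sum hP.isBody h1 h2, edgeSum_eq_sum hP.isBody h1 h2,
    edgeSum_eq_sum hP.isBody h1 h2, ← Finset.sum_add_distrib]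
  exact Finset.sum_congr rfl fun v _ => mul_add _ _ _

theorem edgeSum_const_mul (hP : IsLatticePolygon P) (c : ℝ) (φ : (Fin 2 → ℝ) → ℝ) :
    edgeSum P (fun v => c * φ v) = c * edgeSum P φ := by
  have h1 : fan P ⊆ (hP.finite_fan.toFinset : Set (Fin 2 → ℤ)) := by simp
  have h2 : ∀ v ∈ hP.finite_fan.toFinset, IsCoprime (v 0) (v 1) := fun v hv => by
    rw [Finite.mem_toFinset] at hv; exact hv.1
  rw [edgeSum_eq_sum hP.isBody h1 h2, edgeSum_eq_sum hP.isBody h1 h2, Finset.mul_sum]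
  exact Finset.sum_congr rfl fun v _ => mul_left_comm _ _ _

theorem edgeSum_mono (hP : IsLatticePolygon P) {φ ψ : (Fin 2 → ℝ) → ℝ} (h : ∀ v, φ v ≤ ψ v) :
    edgeSum P φ ≤ edgeSum P ψ := by
  have h1 : fan P ⊆ (hP.finite_fan.toFinset : Set (Fin 2 → ℤ)) := by simp
  have h2 : ∀ v ∈ hP.finite_fan.toFinset, IsCoprime (v 0) (v 1) := fun v hv => by
    rw [Finite.mem_toFinset] at hv; exact hv.1
  rw [edgeSum_eq_sum hP.isBody h1 h2, edgeSum_eq_sum hP.isBody h1 h2]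
  refine Finset.sum_le_sum fun v hv => mul_le_mul_of_nonneg_left (h _) ?_
  exact hP.isBody.edgeLength_nonneg (latticePt_ne_zero (h2 v hv))

theorem edgeSum_eq_zero_iff (hP : IsLatticePolygon P) {φ : (Fin 2 → ℝ) → ℝ}
    (h : ∀ v ∈ fan P, 0 ≤ φ (latticePt v)) :
    edgeSum P φ = 0 ↔ ∀ v ∈ fan P, φ (latticePt v) = 0 := by
  have h1 : fan P ⊆ (hP.finite_fan.toFinset : Set (Fin 2 → ℤ)) := by simp
  have h2 : ∀ v ∈ hP.finite_fan.toFinset, IsCoprime (v 0) (v 1) := fun v hv => by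
    rw [Finite.mem_toFinset] at hv; exact hv.1
  have hpos : ∀ v ∈ fan P, 0 < edgeLength P (latticePt v) := fun v hv =>
    hP.isBody.edgeLength_pos (latticePt_ne_zero hv.1) hv.2
  rw [edgeSum_eq_sum hP.isBody h1 h2, Finset.sum_eq_zero_iff_of_nonneg]
  · simp only [Finite.mem_toFinset]
    refine forall₂_congr fun v hv => ?_
    rw [mul_eq_zero, or_iff_right (hpos v hv).ne']
  · intro v hv
    rw [Finite.mem_toFinset] at hv
    exact mul_nonneg (hpos v hv).le (h v hv)

end IsLatticePolygon

/-! ### Edge sums of segments and triangles -/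

/-- Every nonzero lattice vector, rotated, is a positive multiple of a primitive one. -/
theorem exists_primitive {e : Fin 2 → ℤ} (he : e ≠ 0) : ∃ (d : ℤ) (v : Fin 2 → ℤ), 0 < d ∧
    IsCoprime (v 0) (v 1) ∧ e 1 = d * v 0 ∧ -e 0 = d * v 1 := by
  have hg : 0 < Int.gcd (e 0) (e 1) := by
    rw [Int.gcd_pos_iff]
    by_contra h
    push Not at h
    exact he (by ext i; fin_cases i; exacts [h.1, h.2])
  obtain ⟨a, b, hab, ha, hb⟩ := Int.exists_gcd_one hg
  refine ⟨Int.gcd (e 0) (e 1), ![b, -a], by exact_mod_cast hg, ?_, ?_, ?_⟩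
  · exact (Int.isCoprime_iff_gcd_eq_one.2 hab).symm.neg_right
  · simpa [mul_comm] using hb
  · simpa [mul_comm] using ha

/-- The positive factor is recovered as the gcd of the coordinates. -/
theorem eq_of_mul_eq_mul {m d : ℤ} (hm : 0 < m) (hd : 0 < d) {u v : Fin 2 → ℤ}
    (hu : IsCoprime (u 0) (u 1)) (hv : IsCoprime (v 0) (v 1)) (h0 : m * u 0 = d * v 0)
    (h1 : m * u 1 = d * v 1) : u = v := by
  have hmd : m = d := by
    have e1 : Int.gcd (m * u 0) (m * u 1) = m.natAbs := by
      rw [Int.gcd_mul_left, Int.isCoprime_iff_gcd_eq_one.1 hu, mul_one]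
    have e2 : Int.gcd (d * v 0) (d * v 1) = d.natAbs := by
      rw [Int.gcd_mul_left, Int.isCoprime_iff_gcd_eq_one.1 hv, mul_one]
    rw [h0, h1, e2] at e1
    omega
  subst hmd
  ext i
  fin_cases i
  · exact mul_left_cancel₀ hm.ne' h0
  · exact mul_left_cancel₀ hm.ne' h1

theorem rot_latticePt_eq {d : ℤ} {e v : Fin 2 → ℤ} (h0 : e 1 = d * v 0) (h1 : -e 0 = d * v 1) :
    rot (latticePt e) = (d : ℝ) • latticePt v := by
  refine plane_ext ?_ ?_
  · simp only [rot, latticePt, Matrix.cons_val_zero, Pi.smul_apply, smul_eq_mul]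
    exact_mod_cast h0
  · simp only [rot, latticePt, Matrix.cons_val_one, Matrix.cons_val_fin_one, Pi.smul_apply,
      smul_eq_mul]
    exact_mod_cast h1

theorem face_latticeHull_pair {p q : Fin 2 → ℤ} {s : Finset (Fin 2 → ℤ)} (hp : p ∈ s)
    (hq : q ∈ s) {v : Fin 2 → ℝ} (h : latticePt p ⬝ᵥ v = latticePt q ⬝ᵥ v)
    (hlt : ∀ r ∈ s, r ≠ p → r ≠ q → latticePt r ⬝ᵥ v < latticePt p ⬝ᵥ v) :
    face (latticeHull s) v = segment ℝ (latticePt p) (latticePt q) := by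
  have hB : IsBody (latticeHull s) := (isLatticePolygon_latticeHull ⟨p, hp⟩).isBody
  have hle : ∀ r ∈ s, latticePt r ⬝ᵥ v ≤ latticePt p ⬝ᵥ v := by
    intro r hr
    by_cases h1 : r = p
    · rw [h1]
    by_cases h2 : r = q
    · rw [h2, h]
    exact (hlt r hr h1 h2).le
  have hl : supportFun (latticeHull s) v = latticePt p ⬝ᵥ v := by
    refine hB.supportFun_eq (latticePt_mem_latticeHull hp) fun y hy => ?_
    refine convexHull_min (t := {y | y ⬝ᵥ v ≤ latticePt p ⬝ᵥ v}) ?_ ?_ hy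
    · rintro _ ⟨r, hr, rfl⟩
      exact hle r hr
    · exact convex_halfSpace_le (isLinearMap_dot _) _
  rw [latticeHull, face_convexHull hB, ← latticeHull, hl, ← convexHull_pair]
  congr 1
  ext x
  constructor
  · rintro ⟨⟨r, hr, rfl⟩, hrv⟩
    by_cases h1 : r = p
    · rw [h1]; simp
    by_cases h2 : r = q
    · rw [h2]; simp
    exact absurd hrv (hlt r hr h1 h2).ne
  · rintro (rfl | rfl)
    · exact ⟨⟨p, hp, rfl⟩, rfl⟩
    · exact ⟨⟨q, hq, rfl⟩, h.symm⟩

/-- An edge `[p, q]` of a hull contributes `φ` of its rotated direction vector to `edgeSum`. -/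
theorem exists_normal_of_edge {p q : Fin 2 → ℤ} {s : Finset (Fin 2 → ℤ)} (hp : p ∈ s)
    (hq : q ∈ s) (hpq : p ≠ q)
    (hlt : ∀ r ∈ s, r ≠ p → r ≠ q → latticePt r ⬝ᵥ rot (latticePt q - latticePt p) <
      latticePt p ⬝ᵥ rot (latticePt q - latticePt p)) :
    ∃ (d : ℤ) (v : Fin 2 → ℤ), 0 < d ∧ IsCoprime (v 0) (v 1) ∧
      rot (latticePt q - latticePt p) = (d : ℝ) • latticePt v ∧
      edgeLength (latticeHull s) (latticePt v) = d ∧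
      (∀ u : Fin 2 → ℤ, IsCoprime (u 0) (u 1) → ∀ k : ℤ, 0 < k →
        (q - p) 1 = k * u 0 → -(q - p) 0 = k * u 1 → u = v) := by
  obtain ⟨d, v, hd, hv, h0, h1⟩ := exists_primitive (e := q - p)
    (fun h => hpq (sub_eq_zero.1 h).symm)
  have hrot : rot (latticePt q - latticePt p) = (d : ℝ) • latticePt v := by
    rw [← latticePt_sub]; exact rot_latticePt_eq h0 h1
  have hd' : (0 : ℝ) < d := by exact_mod_cast hd
  refine ⟨d, v, hd, hv, hrot, ?_, ?_⟩
  · refine edgeLength_of_face_eq_segment (latticePt_ne_zero hv) hd'.le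
      (face_latticeHull_pair hp hq ?_ ?_) hrot
    · have := dot_rot_self (latticePt q - latticePt p)
      rw [hrot, dotProduct_smul, smul_eq_mul, mul_eq_zero, or_iff_right hd'.ne',
        sub_dotProduct] at this
      linarith
    · intro r hr hrp hrq
      have := hlt r hr hrp hrq
      rw [hrot, dotProduct_smul, dotProduct_smul, smul_eq_mul, smul_eq_mul] at this
      exact lt_of_mul_lt_mul_left this hd'.le
  · intro u hu k hk e0 e1
    exact eq_of_mul_eq_mul hk hd hu hv (by rw [← e0, h0]) (by rw [← e1, h1])

/-- A function that is positively homogeneous of degree one. -/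
def PosHomogeneous (φ : (Fin 2 → ℝ) → ℝ) : Prop := ∀ (c : ℝ), 0 ≤ c → ∀ v, φ (c • v) = c * φ v

theorem IsBody.posHomogeneous {K : Set (Fin 2 → ℝ)} (hK : IsBody K) :
    PosHomogeneous (supportFun K) := fun _ hc v => hK.supportFun_smul hc v

/-- A segment is its own face in both normal directions, so its lattice length `d` is counted twice.
This convention makes edge sums cut-additive and Pick's formula valid for segments. -/
theorem edgeSum_pair {p q : Fin 2 → ℤ} (hpq : p ≠ q) :
    ∃ (d : ℤ) (v : Fin 2 → ℤ), 0 < d ∧ IsCoprime (v 0) (v 1) ∧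
      rot (latticePt q - latticePt p) = (d : ℝ) • latticePt v ∧
      ∀ φ, edgeSum (latticeHull {p, q}) φ = d * φ (latticePt v) + d * φ (-latticePt v) := by
  have hB : IsBody (latticeHull {p, q}) :=
    (isLatticePolygon_latticeHull (Finset.insert_nonempty p _)).isBody
  obtain ⟨d, v, hd, hv, hrot, hlen, huniq⟩ := exists_normal_of_edge (s := {p, q}) (p := p) (q := q)
    (by simp) (by simp) hpq (by simp)
  obtain ⟨d', v', hd', hv', hrot', hlen', huniq'⟩ := exists_normal_of_edge (s := {p, q})
    (p := q) (q := p) (by simp) (by simp) hpq.symm (by simp)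
  have hvr : (d' : ℝ) • latticePt v' = -((d : ℝ) • latticePt v) := by
    rw [← hrot, ← hrot', ← rot_neg, neg_sub]
  have hcoord : ∀ i, d' * v' i = d * (-v) i := by
    intro i
    have := congrFun hvr i
    simp only [latticePt, Pi.smul_apply, Pi.neg_apply, smul_eq_mul] at this ⊢
    rw [mul_neg]
    exact_mod_cast this
  have hvneg : IsCoprime ((-v) 0) ((-v) 1) := hv.neg_neg
  obtain rfl : v' = -v := eq_of_mul_eq_mul hd' hd hv' hvneg (hcoord 0) (hcoord 1)
  have hv0 : latticePt v ≠ 0 := latticePt_ne_zero hv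
  have hdd : d' = d := by
    by_contra hne
    have h0 := hcoord 0
    have h1 := hcoord 1
    have z0 : (-v) 0 = 0 := by by_contra h; exact hne (mul_right_cancel₀ h h0)
    have z1 : (-v) 1 = 0 := by by_contra h; exact hne (mul_right_cancel₀ h h1)
    rw [z0, z1] at hvneg
    exact not_isCoprime_zero_zero hvneg
  subst hdd
  refine ⟨d', v, hd, hv, hrot, fun φ => ?_⟩
  have hvv : v ≠ -v := by
    intro h
    have : latticePt v = -latticePt v := by rw [← latticePt_neg, ← h]
    exact hv0 (self_eq_neg.1 this)
  rw [edgeSum_eq_sum hB (F := {v, -v})]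
  · rw [Finset.sum_pair hvv, hlen, hlen', latticePt_neg]
  · intro u hu
    obtain ⟨x, hx, y, hy, hxy, h1, h2⟩ := exists_of_mem_fan (Finset.insert_nonempty p _) hu
    obtain ⟨k, hk, e0, e1⟩ := exists_rot_sub_eq_smul hu.1 hpq
      (by simp only [Finset.mem_insert, Finset.mem_singleton] at hx hy
          rcases hx with rfl | rfl <;> rcases hy with rfl | rfl
          · exact absurd rfl hxy
          · exact h1.trans h2.symm
          · exact h2.trans h1.symm
          · exact absurd rfl hxy)
    simp only [Finset.coe_insert, Finset.coe_singleton, mem_insert_iff, mem_singleton_iff]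
    rcases hk.lt_or_gt with hk | hk
    · right
      refine huniq' u hu.1 (-k) (by omega) ?_ ?_ <;> simp only [Pi.sub_apply] at e0 e1 ⊢ <;>
        linarith
    · exact Or.inl (huniq u hu.1 k hk e0 e1)
  · intro u hu
    simp only [Finset.mem_insert, Finset.mem_singleton] at hu
    rcases hu with rfl | rfl
    · exact hv
    · exact hvneg

/-- `edgeSum` of a triangle. -/
theorem edgeSum_triangle {p q r : Fin 2 → ℤ}
    (hD : 0 < triangleDet (latticePt p) (latticePt q) (latticePt r)) {φ : (Fin 2 → ℝ) → ℝ}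
    (hφ : PosHomogeneous φ) :
    edgeSum (latticeHull {p, q, r}) φ = φ (rot (latticePt q - latticePt p)) +
      φ (rot (latticePt r - latticePt q)) + φ (rot (latticePt p - latticePt r)) := by
  set s : Finset (Fin 2 → ℤ) := {p, q, r} with hs
  have hps : p ∈ s := by simp [hs]
  have hqs : q ∈ s := by simp [hs]
  have hrs : r ∈ s := by simp [hs]
  have hB : IsBody (latticeHull s) := (isLatticePolygon_latticeHull ⟨p, hps⟩).isBody
  have hdot : ∀ x y z : Fin 2 → ℝ, z ⬝ᵥ rot (y - x) = x ⬝ᵥ rot (y - x) - triangleDet x y z := by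
    intro x y z
    simp only [triangleDet, cross, Pi.sub_apply, dot_eq, rot, Matrix.cons_val_zero,
      Matrix.cons_val_one, Matrix.cons_val_fin_one]
    ring
  have hcyc : ∀ x y z : Fin 2 → ℝ, triangleDet y z x = triangleDet x y z := by
    intro x y z
    simp only [triangleDet, cross, Pi.sub_apply]; ring
  have hne : ∀ x y z : Fin 2 → ℤ, 0 < triangleDet (latticePt x) (latticePt y) (latticePt z) →
      x ≠ y := by
    rintro x y z h rfl
    simp [triangleDet, cross] at h
  have hD2 := hcyc (latticePt p) (latticePt q) (latticePt r) ▸ hD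
  have hD3 := hcyc (latticePt q) (latticePt r) (latticePt p) ▸ hD2
  -- For a positively oriented triangle the third vertex lies strictly to the left of each directed
  -- edge, so the clockwise rotation of the edge is an outer normal.
  have main : ∀ x y z : Fin 2 → ℤ, 0 < triangleDet (latticePt x) (latticePt y) (latticePt z) →
      x ∈ s → y ∈ s → z ∈ s → (∀ w ∈ s, w = x ∨ w = y ∨ w = z) →
      ∃ v : Fin 2 → ℤ, IsCoprime (v 0) (v 1) ∧
      (∃ d : ℝ, 0 < d ∧ rot (latticePt y - latticePt x) = d • latticePt v) ∧
      edgeLength (latticeHull s) (latticePt v) * φ (latticePt v) =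
        φ (rot (latticePt y - latticePt x)) ∧
      ∀ u : Fin 2 → ℤ, IsCoprime (u 0) (u 1) →
        latticePt x ⬝ᵥ latticePt u = supportFun (latticeHull s) (latticePt u) →
        latticePt y ⬝ᵥ latticePt u = supportFun (latticeHull s) (latticePt u) → u = v := by
    intro x y z h hx hy hz hall
    have hxy := hne x y z h
    obtain ⟨d, v, hd, hv, hrot, hlen, huniq⟩ := exists_normal_of_edge hx hy hxy (by
      intro w hw hwx hwy
      obtain rfl : w = z := by
        rcases hall w hw with h | h | h
        exacts [absurd h hwx, absurd h hwy, h]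
      rw [hdot (latticePt x) (latticePt y) (latticePt w)]
      linarith)
    have hd' : (0 : ℝ) < d := by exact_mod_cast hd
    refine ⟨v, hv, ⟨d, hd', hrot⟩, by rw [hlen, hrot, hφ _ hd'.le], ?_⟩
    intro u hu h1 h2
    obtain ⟨k, hk, e0, e1⟩ := exists_rot_sub_eq_smul hu hxy (h1.trans h2.symm)
    have hr := rot_latticePt_eq e0 e1
    rw [latticePt_sub] at hr
    have h3 := hB.le_supportFun (latticePt_mem_latticeHull hz) (latticePt u)
    have h4 := hdot (latticePt x) (latticePt y) (latticePt z)
    rw [hr, dotProduct_smul, dotProduct_smul, smul_eq_mul, smul_eq_mul] at h4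
    refine huniq u hu k ?_ e0 e1
    by_contra hk'
    have : (k : ℝ) ≤ 0 := by exact_mod_cast not_lt.1 hk'
    nlinarith
  obtain ⟨v₁, hv₁, ⟨d₁, hd₁, hr₁⟩, hφ₁, hu₁⟩ := main p q r hD hps hqs hrs (by simp [hs])
  obtain ⟨v₂, hv₂, ⟨d₂, hd₂, hr₂⟩, hφ₂, hu₂⟩ := main q r p hD2 hqs hrs hps (by simp [hs])
  obtain ⟨v₃, hv₃, ⟨d₃, hd₃, hr₃⟩, hφ₃, hu₃⟩ := main r p q hD3 hrs hps hqs (by simp [hs])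
  -- Consecutive edges with a common normal line would be parallel, and the determinant would
  -- vanish.
  have hdist : ∀ x y z : Fin 2 → ℤ, 0 < triangleDet (latticePt x) (latticePt y) (latticePt z) →
      ∀ (u : Fin 2 → ℤ) (a b : ℝ), rot (latticePt y - latticePt x) = a • latticePt u →
      rot (latticePt z - latticePt y) = b • latticePt u → False := by
    intro x y z h u a b h1 h2
    have h10 := congrFun h1 0
    have h11 := congrFun h1 1
    have h20 := congrFun h2 0
    have h21 := congrFun h2 1
    simp only [rot, Matrix.cons_val_zero, Matrix.cons_val_one, Matrix.cons_val_fin_one,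
      Pi.smul_apply, Pi.sub_apply, smul_eq_mul] at h10 h11 h20 h21
    simp only [triangleDet, cross, Pi.sub_apply] at h
    refine h.ne' ?_
    linear_combination (-(latticePt z 1 - latticePt y 1)) * h11 - a * latticePt u 1 * h20 -
      (latticePt z 0 - latticePt y 0) * h10 + a * latticePt u 0 * h21
  have h12 : v₁ ≠ v₂ := by rintro rfl; exact hdist p q r hD _ _ _ hr₁ hr₂
  have h23 : v₂ ≠ v₃ := by rintro rfl; exact hdist q r p hD2 _ _ _ hr₂ hr₃
  have h31 : v₃ ≠ v₁ := by rintro rfl; exact hdist r p q hD3 _ _ _ hr₃ hr₁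
  rw [edgeSum_eq_sum hB (F := {v₁, v₂, v₃})]
  · rw [Finset.sum_insert (by simp [h12, h31.symm]), Finset.sum_pair h23, hφ₁, hφ₂, hφ₃, add_assoc]
  · intro u hu
    obtain ⟨x, hx, y, hy, hxy, h1, h2⟩ := exists_of_mem_fan ⟨p, hps⟩ hu
    simp only [Finset.coe_insert, Finset.coe_singleton, mem_insert_iff, mem_singleton_iff]
    simp only [hs, Finset.mem_insert, Finset.mem_singleton] at hx hy
    rcases hx with rfl | rfl | rfl <;> rcases hy with rfl | rfl | rfl
    · exact absurd rfl hxy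
    · exact Or.inl (hu₁ u hu.1 h1 h2)
    · exact Or.inr (Or.inr (hu₃ u hu.1 h2 h1))
    · exact Or.inl (hu₁ u hu.1 h2 h1)
    · exact absurd rfl hxy
    · exact Or.inr (Or.inl (hu₂ u hu.1 h1 h2))
    · exact Or.inr (Or.inr (hu₃ u hu.1 h1 h2))
    · exact Or.inr (Or.inl (hu₂ u hu.1 h2 h1))
    · exact absurd rfl hxy
  · intro u hu
    simp only [Finset.mem_insert, Finset.mem_singleton] at hu
    rcases hu with rfl | rfl | rfl <;> assumption

/-! ### Areas of Minkowski sums -/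

theorem area_singleton_add (p : Fin 2 → ℝ) (K : Set (Fin 2 → ℝ)) : area ({p} + K) = area K := by
  rw [area, area, singleton_add, image_add_left, measure_preimage_add]

theorem area_smul (c : ℝ) (K : Set (Fin 2 → ℝ)) : area (c • K) = c ^ 2 * area K := by
  rw [area, area, Measure.addHaar_smul, ENNReal.toReal_mul,
    ENNReal.toReal_ofReal (abs_nonneg _), abs_of_nonneg (by simp; positivity)]
  simp

theorem area_neg (K : Set (Fin 2 → ℝ)) : area (-K) = area K := by
  rw [area, area, Measure.measure_neg]

theorem area_mono_of_isCompact {K L : Set (Fin 2 → ℝ)} (hL : IsCompact L) (h : K ⊆ L) :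
    area K ≤ area L :=
  ENNReal.toReal_mono hL.measure_lt_top.ne (measure_mono h)

/-- A point written as `x + r = y + s`, with `x` and `y` on opposite sides of the line, equals every
convex combination of the two representations; the weights are chosen to put the `K`-part on the
line. -/
theorem cut_add_inter_cut_add {K R : Set (Fin 2 → ℝ)} (hK : Convex ℝ K) (hR : Convex ℝ R)
    (n : Fin 2 → ℝ) (c : ℝ) :
    (K ∩ {x | x ⬝ᵥ n ≤ c} + R) ∩ (K ∩ {x | c ≤ x ⬝ᵥ n} + R) = K ∩ {x | x ⬝ᵥ n = c} + R := by
  refine subset_antisymm ?_ (subset_inter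
    (add_subset_add_right (inter_subset_inter_right _ fun x hx => le_of_eq hx))
    (add_subset_add_right (inter_subset_inter_right _ fun x hx => ge_of_eq hx)))
  rintro _ ⟨⟨x, ⟨hx, hxc⟩, r, hr, rfl⟩, y, ⟨hy, hyc⟩, s, hs, he⟩
  obtain ⟨t, ht0, ht1, ht⟩ := exists_combination_eq hxc hyc
  refine ⟨(1 - t) • x + t • y, ⟨hK hx hy (by linarith) ht0 (by ring), ?_⟩,
    (1 - t) • r + t • s, hR hr hs (by linarith) ht0 (by ring), ?_⟩
  · rw [mem_ofPred_eq, add_dotProduct, smul_dotProduct, smul_dotProduct]; exact ht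
  · have he' : y + s = x + r := he
    calc _ = (1 - t) • (x + r) + t • (y + s) := by simp only []; module
      _ = x + r := by rw [he']; module

/-- Inclusion-exclusion for the two halves. The case `R = {0}` is the additivity of area itself. -/
theorem area_add_cut {K R : Set (Fin 2 → ℝ)} (hK : IsBody K) (hR : IsBody R)
    (n : Fin 2 → ℝ) (c : ℝ) :
    area (K + R) + area (K ∩ {x | x ⬝ᵥ n = c} + R) =
      area (K ∩ {x | x ⬝ᵥ n ≤ c} + R) + area (K ∩ {x | c ≤ x ⬝ᵥ n} + R) := by
  have h1 : IsCompact (K ∩ {x | x ⬝ᵥ n ≤ c} + R) :=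
    (hK.compact.inter_right (isClosed_le (continuous_dot n) continuous_const)).add hR.compact
  have h2 : IsCompact (K ∩ {x | c ≤ x ⬝ᵥ n} + R) :=
    (hK.compact.inter_right (isClosed_le continuous_const (continuous_dot n))).add hR.compact
  have hU : K + R = (K ∩ {x | x ⬝ᵥ n ≤ c} + R) ∪ (K ∩ {x | c ≤ x ⬝ᵥ n} + R) := by
    rw [← union_add, ← inter_union_distrib_left]
    congr 1
    exact (inter_eq_left.2 fun x _ => le_total (x ⬝ᵥ n) c).symm
  have := measure_union_add_inter (μ := volume) (K ∩ {x | x ⬝ᵥ n ≤ c} + R) h2.measurableSet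
  rw [← hU, cut_add_inter_cut_add hK.convex hR.convex] at this
  rw [area, area, area, area, ← ENNReal.toReal_add, ← ENNReal.toReal_add, this]
  · exact h1.measure_lt_top.ne
  · exact h2.measure_lt_top.ne
  · exact (hK.add hR).compact.measure_lt_top.ne
  · refine ((measure_mono ?_).trans_lt h1.measure_lt_top).ne
    exact add_subset_add_right (inter_subset_inter_right _ fun x hx => le_of_eq hx)

/-- The linear map of the plane with the given columns. -/
def columnMap (a b : Fin 2 → ℝ) : (Fin 2 → ℝ) →ₗ[ℝ] (Fin 2 → ℝ) :=
  Matrix.toLin' !![a 0, b 0; a 1, b 1]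

theorem columnMap_apply (a b x : Fin 2 → ℝ) : columnMap a b x = x 0 • a + x 1 • b := by
  refine plane_ext ?_ ?_ <;>
    simp [columnMap, Matrix.toLin'_apply, Matrix.mulVec, dotProduct, Fin.sum_univ_two, mul_comm]

theorem det_columnMap (a b : Fin 2 → ℝ) : LinearMap.det (columnMap a b) = cross a b := by
  rw [columnMap, LinearMap.det_toLin', Matrix.det_fin_two_of, cross]; ring

theorem segment_zero_eq (a : Fin 2 → ℝ) :
    segment ℝ 0 a = {x | ∃ t : ℝ, 0 ≤ t ∧ t ≤ 1 ∧ x = t • a} := by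
  ext x
  constructor
  · rintro ⟨s, t, hs, ht, hst, rfl⟩
    exact ⟨t, ht, by linarith, by simp⟩
  · rintro ⟨t, h0, h1, rfl⟩
    exact ⟨1 - t, t, by linarith, h0, by ring, by simp⟩

theorem area_parallelogram (a b : Fin 2 → ℝ) :
    area (segment ℝ 0 a + segment ℝ 0 b) = |cross a b| := by
  have h : segment ℝ 0 a + segment ℝ 0 b = columnMap a b '' Icc 0 1 := by
    rw [segment_zero_eq, segment_zero_eq]
    ext x
    constructor
    · rintro ⟨_, ⟨s, hs0, hs1, rfl⟩, _, ⟨t, ht0, ht1, rfl⟩, rfl⟩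
      refine ⟨![s, t], ⟨?_, ?_⟩, by simp [columnMap_apply]⟩ <;> intro i <;> fin_cases i <;>
        simpa
    · rintro ⟨y, ⟨h0, h1⟩, rfl⟩
      rw [columnMap_apply]
      exact Set.add_mem_add ⟨y 0, h0 0, h1 0, rfl⟩ ⟨y 1, h0 1, h1 1, rfl⟩
  rw [h, area, Measure.addHaar_image_linearMap, det_columnMap, Real.volume_Icc_pi]
  simp [abs_nonneg]

theorem area_segment (a b : Fin 2 → ℝ) : area (segment ℝ a b) = 0 := by
  have h : segment ℝ a b = {a} + segment ℝ 0 (b - a) := by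
    have := segment_translate_image ℝ a 0 (b - a)
    rw [add_zero, add_sub_cancel] at this
    rw [← this, singleton_add]
  have := area_parallelogram (b - a) 0
  rw [segment_same, singleton_zero, add_zero] at this
  rw [h, area_singleton_add, this]
  simp [cross]

/-- The area of the parallelogram cut out by two strips. -/
theorem volume_strips {m n : Fin 2 → ℝ} (hmn : cross m n ≠ 0) {a b c d : ℝ} :
    volume {x | (a ≤ x ⬝ᵥ m ∧ x ⬝ᵥ m ≤ b) ∧ c ≤ x ⬝ᵥ n ∧ x ⬝ᵥ n ≤ d} =
      ENNReal.ofReal |cross m n|⁻¹ * (ENNReal.ofReal (b - a) * ENNReal.ofReal (d - c)) := by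
  set f : (Fin 2 → ℝ) →ₗ[ℝ] (Fin 2 → ℝ) := Matrix.toLin' !![m 0, m 1; n 0, n 1] with hf
  have hfx : ∀ x, f x = ![x ⬝ᵥ m, x ⬝ᵥ n] := by
    intro x
    rw [dot_eq, dot_eq]
    refine plane_ext ?_ ?_ <;>
      simp [hf, Matrix.toLin'_apply, Matrix.mulVec, dotProduct, Fin.sum_univ_two, mul_comm]
  have hdet : LinearMap.det f = cross m n := by
    rw [hf, LinearMap.det_toLin', Matrix.det_fin_two_of, cross]
  have h : {x | (a ≤ x ⬝ᵥ m ∧ x ⬝ᵥ m ≤ b) ∧ c ≤ x ⬝ᵥ n ∧ x ⬝ᵥ n ≤ d} =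
      f ⁻¹' Icc ![a, c] ![b, d] := by
    ext x
    rw [mem_preimage, hfx]
    simp only [mem_ofPred_eq, mem_Icc, Pi.le_def, Fin.forall_fin_two, Matrix.cons_val_zero,
      Matrix.cons_val_one, Matrix.cons_val_fin_one]
    tauto
  rw [h, Measure.addHaar_preimage_linearMap _ (by rwa [hdet]), hdet, Real.volume_Icc_pi, abs_inv]
  simp [Fin.prod_univ_two]

/-- Used to discard bounded errors: quantities that scale exactly by `2 ^ k` are compared up to a
constant independent of `k`. -/
theorem le_of_forall_two_pow {x y c : ℝ} (h : ∀ k : ℕ, 2 ^ k * x ≤ 2 ^ k * y + c) : x ≤ y := by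
  by_contra hxy
  push Not at hxy
  have ht : Tendsto (fun k : ℕ => (2 : ℝ) ^ k * (x - y)) atTop atTop :=
    (tendsto_pow_atTop_atTop_of_one_lt one_lt_two).atTop_mul_const (sub_pos.2 hxy)
  obtain ⟨k, hk⟩ := (ht.eventually_gt_atTop c).exists
  have := h k
  linarith

theorem segment_zero_two_smul_cut {a : Fin 2 → ℝ} (ha : a ≠ 0) :
    segment ℝ 0 ((2 : ℝ) • a) ∩ {x | x ⬝ᵥ a ≤ a ⬝ᵥ a} = segment ℝ 0 a ∧
    segment ℝ 0 ((2 : ℝ) • a) ∩ {x | a ⬝ᵥ a ≤ x ⬝ᵥ a} = {a} + segment ℝ 0 a ∧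
    segment ℝ 0 ((2 : ℝ) • a) ∩ {x | x ⬝ᵥ a = a ⬝ᵥ a} = {a} := by
  have haa := dot_self_pos ha
  rw [segment_zero_eq, segment_zero_eq]
  refine ⟨?_, ?_, ?_⟩
  · ext x
    constructor
    · rintro ⟨⟨t, h0, h1, rfl⟩, h⟩
      rw [mem_ofPred_eq, smul_smul, smul_dotProduct, smul_eq_mul] at h
      exact ⟨t * 2, by linarith, by nlinarith, by rw [smul_smul]⟩
    · rintro ⟨t, h0, h1, rfl⟩
      refine ⟨⟨t / 2, by linarith, by linarith, by rw [smul_smul]; congr 1; ring⟩, ?_⟩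
      rw [mem_ofPred_eq, smul_dotProduct, smul_eq_mul]
      nlinarith
  · ext x
    rw [singleton_add]
    constructor
    · rintro ⟨⟨t, h0, h1, rfl⟩, h⟩
      rw [mem_ofPred_eq, smul_smul, smul_dotProduct, smul_eq_mul] at h
      exact ⟨(t * 2 - 1) • a, ⟨t * 2 - 1, by nlinarith, by linarith, rfl⟩, by module⟩
    · rintro ⟨_, ⟨t, h0, h1, rfl⟩, rfl⟩
      refine ⟨⟨(1 + t) / 2, by linarith, by linarith, by module⟩, ?_⟩
      rw [mem_ofPred_eq, add_dotProduct, smul_dotProduct, smul_eq_mul]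
      nlinarith
  · ext x
    constructor
    · rintro ⟨⟨t, h0, h1, rfl⟩, h⟩
      rw [mem_ofPred_eq, smul_smul, smul_dotProduct, smul_eq_mul] at h
      have : t * 2 = 1 := mul_right_cancel₀ haa.ne' (by rw [h, one_mul])
      rw [smul_smul, this, one_smul]; rfl
    · rintro rfl
      exact ⟨⟨1 / 2, by norm_num, by norm_num, by module⟩, rfl⟩

/-- The area of the sum of a convex body and a segment. -/
theorem area_segment_add {R : Set (Fin 2 → ℝ)} (hR : IsBody R) (a : Fin 2 → ℝ) :
    area (segment ℝ 0 a + R) = area R + (supportFun R (rot a) + supportFun R (-rot a)) := by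
  rcases eq_or_ne a 0 with rfl | ha
  · have : rot 0 = 0 := plane_ext (by simp [rot]) (by simp [rot])
    simp [this, hR.supportFun_zero]
  have haa := dot_self_pos ha
  -- Cutting a doubled segment at its midpoint gives two translates of the segment, and the section
  -- contributes `area R` once.
  have hdouble : ∀ k : ℕ, area (segment ℝ 0 ((2 : ℝ) ^ k • a) + R) - area R =
      2 ^ k * (area (segment ℝ 0 a + R) - area R) := by
    intro k
    induction k with
    | zero => simp
    | succ k ih =>
      have hne : (2 : ℝ) ^ k • a ≠ 0 := smul_ne_zero (by positivity) ha
      obtain ⟨h1, h2, h3⟩ := segment_zero_two_smul_cut hne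
      have := area_add_cut (isBody_segment 0 ((2 : ℝ) • (2 : ℝ) ^ k • a)) hR ((2 : ℝ) ^ k • a)
        (((2 : ℝ) ^ k • a) ⬝ᵥ ((2 : ℝ) ^ k • a))
      rw [h1, h2, h3, add_assoc, area_singleton_add, area_singleton_add, smul_smul,
        ← pow_succ'] at this
      rw [pow_succ' (2 : ℝ) k, mul_assoc, ← ih, ← pow_succ']
      linarith
  set w := supportFun R (rot a) + supportFun R (-rot a) with hw
  set g := area (segment ℝ 0 a + R) - area R with hg
  have hcr : ∀ y : Fin 2 → ℝ, cross a y = -(y ⬝ᵥ rot a) := by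
    intro y; rw [dot_eq]; simp [cross, rot]; ring
  obtain ⟨y, hy, hyw⟩ := hR.exists_mem_supportFun (rot a)
  obtain ⟨z, hz, hzw⟩ := hR.exists_mem_supportFun (-rot a)
  have hw0 : 0 ≤ w := by
    have h1 := hR.le_supportFun hy (-rot a)
    rw [dotProduct_neg] at h1
    linarith
  have hupper : g ≤ w := by
    obtain ⟨C, hC0, hC⟩ : ∃ C : ℝ, 0 ≤ C ∧ ∀ x ∈ R, -C ≤ x ⬝ᵥ a ∧ x ⬝ᵥ a ≤ C := by
      refine ⟨|supportFun R a| + |supportFun R (-a)|, by positivity, fun x hx => ?_⟩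
      have h1 := hR.le_supportFun hx a
      have h2 := hR.le_supportFun hx (-a)
      rw [dotProduct_neg] at h2
      constructor
      · linarith [le_abs_self (supportFun R (-a)), abs_nonneg (supportFun R a)]
      · linarith [le_abs_self (supportFun R a), abs_nonneg (supportFun R (-a))]
    have hcross : cross (rot a) a = a ⬝ᵥ a := by rw [dot_eq]; simp [cross, rot]; ring
    -- The sum with the long segment lies in a rectangle with sides along `a` and `rot a`, whose
    -- area exceeds `2 ^ k * w` by an amount independent of `k`.
    refine le_of_forall_two_pow (c := (a ⬝ᵥ a)⁻¹ * (w * (2 * C)) - area R) fun k => ?_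
    set S := {x : Fin 2 → ℝ | (-supportFun R (-rot a) ≤ x ⬝ᵥ rot a ∧
      x ⬝ᵥ rot a ≤ supportFun R (rot a)) ∧ -C ≤ x ⬝ᵥ a ∧ x ⬝ᵥ a ≤ C + 2 ^ k * (a ⬝ᵥ a)} with hS
    have hsub : segment ℝ 0 ((2 : ℝ) ^ k • a) + R ⊆ S := by
      rw [segment_zero_eq]
      rintro _ ⟨_, ⟨t, ht0, ht1, rfl⟩, r, hr, rfl⟩
      have h1 := hR.le_supportFun hr (rot a)
      have h2 := hR.le_supportFun hr (-rot a)
      obtain ⟨h3, h4⟩ := hC r hr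
      rw [dotProduct_neg] at h2
      simp only [hS, mem_ofPred_eq, add_dotProduct, smul_dotProduct, smul_eq_mul, dot_rot_self,
        mul_zero, zero_add]
      have h5 : 0 ≤ 2 ^ k * (a ⬝ᵥ a) := by positivity
      refine ⟨⟨by linarith, h1⟩, ?_, ?_⟩ <;> nlinarith
    have hSvol := volume_strips (m := rot a) (n := a) (by rw [hcross]; exact haa.ne')
      (a := -supportFun R (-rot a)) (b := supportFun R (rot a)) (c := -C)
      (d := C + 2 ^ k * (a ⬝ᵥ a))
    rw [← hS] at hSvol
    have hSarea : area S = (a ⬝ᵥ a)⁻¹ * (w * (2 * C + 2 ^ k * (a ⬝ᵥ a))) := by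
      have h5 : 0 ≤ 2 ^ k * (a ⬝ᵥ a) := by positivity
      rw [area, hSvol, ENNReal.toReal_mul, ENNReal.toReal_mul, hcross, abs_of_pos haa,
        ENNReal.toReal_ofReal (by positivity), ENNReal.toReal_ofReal (by linarith),
        ENNReal.toReal_ofReal (by linarith), hw]
      ring
    have hle : area (segment ℝ 0 ((2 : ℝ) ^ k • a) + R) ≤ area S := by
      refine ENNReal.toReal_mono ?_ (measure_mono hsub)
      rw [hSvol]
      exact ENNReal.mul_ne_top ENNReal.ofReal_ne_top
        (ENNReal.mul_ne_top ENNReal.ofReal_ne_top ENNReal.ofReal_ne_top)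
    rw [hSarea] at hle
    have := hdouble k
    rw [← this]
    have e : (a ⬝ᵥ a)⁻¹ * (w * (2 * C + 2 ^ k * (a ⬝ᵥ a))) =
        (a ⬝ᵥ a)⁻¹ * (w * (2 * C)) + 2 ^ k * w := by field_simp
    linarith
  have hlower : w ≤ g := by
    -- Conversely the sum contains a parallelogram of area `2 ^ k * w`, spanned by the segment and a
    -- chord of `R` joining its extreme points in the directions `rot a` and `-rot a`.
    refine le_of_forall_two_pow (c := area R) fun k => ?_
    rw [← hdouble k]
    have hsub : {z} + (segment ℝ 0 ((2 : ℝ) ^ k • a) + segment ℝ 0 (y - z)) ⊆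
        segment ℝ 0 ((2 : ℝ) ^ k • a) + R := by
      rw [add_left_comm]
      refine add_subset_add_left ?_
      rw [singleton_add, segment_translate_image, add_zero, add_sub_cancel]
      exact hR.convex.segment_subset hz hy
    have := area_mono_of_isCompact ((isBody_segment _ _).add hR).compact hsub
    rw [area_singleton_add, area_parallelogram] at this
    have e : cross ((2 : ℝ) ^ k • a) (y - z) = -(2 ^ k * w) := by
      have : cross ((2 : ℝ) ^ k • a) (y - z) = 2 ^ k * cross a (y - z) := by
        simp [cross]; ring
      rw [this, hcr, sub_dotProduct]
      rw [dotProduct_neg] at hzw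
      rw [hw, ← hyw, ← hzw]
      ring
    rw [e, abs_neg, abs_of_nonneg (by positivity)] at this
    linarith
  linarith

/-! ### Dissections of triangles and parallelograms -/

/-- The triangle with vertices `0`, `a`, `b`. -/
def triangle (a b : Fin 2 → ℝ) : Set (Fin 2 → ℝ) := convexHull ℝ {0, a, b}

/-- The parallelogram spanned by `a` and `b`. -/
def parallelogram (a b : Fin 2 → ℝ) : Set (Fin 2 → ℝ) := segment ℝ 0 a + segment ℝ 0 b

theorem mem_singleton_add_iff {p x : Fin 2 → ℝ} {K : Set (Fin 2 → ℝ)} :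
    x ∈ {p} + K ↔ x - p ∈ K := by
  rw [singleton_add]
  constructor
  · rintro ⟨y, hy, rfl⟩
    simpa using hy
  · intro h
    exact ⟨_, h, add_sub_cancel p x⟩

theorem cross_smul_eq (a b x : Fin 2 → ℝ) : cross a b • x = cross x b • a + cross a x • b := by
  refine plane_ext ?_ ?_ <;> simp [cross] <;> ring

/-- Cramer's rule. In the coordinates `cross x b` and `cross a x` all the figures below are given by
linear inequalities, and the dissections become linear arithmetic. -/
theorem eq_combination {a b : Fin 2 → ℝ} (hD : 0 < cross a b) (x : Fin 2 → ℝ) :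
    x = (cross x b / cross a b) • a + (cross a x / cross a b) • b := by
  refine smul_right_injective _ hD.ne' ?_
  simp only [smul_add, smul_smul]
  rw [mul_div_cancel₀ _ hD.ne', mul_div_cancel₀ _ hD.ne', cross_smul_eq]

theorem cross_combination_left (a b : Fin 2 → ℝ) (s t : ℝ) :
    cross (s • a + t • b) b = s * cross a b := by
  simp [cross]; ring

theorem cross_combination_right (a b : Fin 2 → ℝ) (s t : ℝ) :
    cross a (s • a + t • b) = t * cross a b := by
  simp [cross]; ring

theorem mem_triangle {a b : Fin 2 → ℝ} (hD : 0 < cross a b) {x : Fin 2 → ℝ} :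
    x ∈ triangle a b ↔ 0 ≤ cross x b ∧ 0 ≤ cross a x ∧ cross x b + cross a x ≤ cross a b := by
  constructor
  · intro hx
    have hl : IsLinearMap ℝ fun x => cross x b := ⟨fun _ _ => by simp [cross]; ring,
      fun _ _ => by simp [cross]; ring⟩
    have hr : IsLinearMap ℝ fun x => cross a x := ⟨fun _ _ => by simp [cross]; ring,
      fun _ _ => by simp [cross]; ring⟩
    have hs : IsLinearMap ℝ fun x => cross x b + cross a x :=
      ⟨fun _ _ => by simp [cross]; ring, fun _ _ => by simp [cross]; ring⟩
    have e1 : cross 0 b = 0 := by simp [cross]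
    have e2 : cross a 0 = 0 := by simp [cross]
    have e3 : cross b b = 0 := by simp [cross]; ring
    have e4 : cross a a = 0 := by simp [cross]; ring
    refine convexHull_min (t := {x | 0 ≤ cross x b} ∩ ({x | 0 ≤ cross a x} ∩
      {x | cross x b + cross a x ≤ cross a b})) ?_ ((convex_halfSpace_ge hl 0).inter
      ((convex_halfSpace_ge hr 0).inter (convex_halfSpace_le hs _))) hx
    rintro y (rfl | rfl | rfl)
    · simp only [mem_inter_iff, mem_ofPred_eq, e1, e2]
      exact ⟨le_rfl, le_rfl, by linarith⟩
    · simp only [mem_inter_iff, mem_ofPred_eq, e4]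
      exact ⟨hD.le, le_rfl, by linarith⟩
    · simp only [mem_inter_iff, mem_ofPred_eq, e3]
      exact ⟨le_rfl, hD.le, by linarith⟩
  · rintro ⟨h1, h2, h3⟩
    have := (convex_convexHull ℝ ({0, a, b} : Set (Fin 2 → ℝ))).add_three_mem
      (subset_convexHull ℝ _ (by simp : (0 : Fin 2 → ℝ) ∈ _))
      (subset_convexHull ℝ _ (by simp : a ∈ _)) (subset_convexHull ℝ _ (by simp : b ∈ _))
      (α := 1 - cross x b / cross a b - cross a x / cross a b) (β := cross x b / cross a b)
      (γ := cross a x / cross a b)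
      (by rw [sub_sub, ← add_div, sub_nonneg, div_le_one hD]; exact h3)
      (div_nonneg h1 hD.le) (div_nonneg h2 hD.le) (by ring)
    rwa [smul_zero, zero_add, ← eq_combination hD] at this

theorem mem_parallelogram {a b : Fin 2 → ℝ} (hD : 0 < cross a b) {x : Fin 2 → ℝ} :
    x ∈ parallelogram a b ↔
      (0 ≤ cross x b ∧ cross x b ≤ cross a b) ∧ 0 ≤ cross a x ∧ cross a x ≤ cross a b := by
  rw [parallelogram, segment_zero_eq, segment_zero_eq]
  constructor
  · rintro ⟨_, ⟨s, hs0, hs1, rfl⟩, _, ⟨t, ht0, ht1, rfl⟩, rfl⟩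
    simp only [cross_combination_left, cross_combination_right]
    refine ⟨⟨?_, ?_⟩, ?_, ?_⟩ <;> nlinarith
  · rintro ⟨⟨h1, h2⟩, h3, h4⟩
    rw [eq_combination hD x]
    exact Set.add_mem_add ⟨_, div_nonneg h1 hD.le, (div_le_one hD).2 h2, rfl⟩
      ⟨_, div_nonneg h3 hD.le, (div_le_one hD).2 h4, rfl⟩

theorem mem_segment_zero_left {a b : Fin 2 → ℝ} (hD : 0 < cross a b) {x : Fin 2 → ℝ} :
    x ∈ segment ℝ 0 a ↔ 0 ≤ cross x b ∧ cross x b ≤ cross a b ∧ cross a x = 0 := by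
  rw [segment_zero_eq]
  constructor
  · rintro ⟨s, hs0, hs1, rfl⟩
    have h1 := cross_combination_left a b s 0
    have h2 := cross_combination_right a b s 0
    rw [zero_smul, add_zero] at h1 h2
    rw [h1, h2]
    refine ⟨?_, ?_, ?_⟩ <;> nlinarith
  · rintro ⟨h1, h2, h3⟩
    refine ⟨_, div_nonneg h1 hD.le, (div_le_one hD).2 h2, ?_⟩
    conv_lhs => rw [eq_combination hD x, h3, zero_div, zero_smul, add_zero]

theorem mem_segment_zero_right {a b : Fin 2 → ℝ} (hD : 0 < cross a b) {x : Fin 2 → ℝ} :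
    x ∈ segment ℝ 0 b ↔ cross x b = 0 ∧ 0 ≤ cross a x ∧ cross a x ≤ cross a b := by
  rw [segment_zero_eq]
  constructor
  · rintro ⟨s, hs0, hs1, rfl⟩
    have h1 := cross_combination_left a b 0 s
    have h2 := cross_combination_right a b 0 s
    rw [zero_smul, zero_add] at h1 h2
    rw [h1, h2]
    refine ⟨?_, ?_, ?_⟩ <;> nlinarith
  · rintro ⟨h1, h2, h3⟩
    refine ⟨_, div_nonneg h2 hD.le, (div_le_one hD).2 h3, ?_⟩
    conv_lhs => rw [eq_combination hD x, h1, zero_div, zero_smul, zero_add]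

theorem mem_segment_of_cross {a b : Fin 2 → ℝ} (hD : 0 < cross a b) {x : Fin 2 → ℝ} :
    x ∈ segment ℝ a b ↔ 0 ≤ cross x b ∧ 0 ≤ cross a x ∧ cross x b + cross a x = cross a b := by
  constructor
  · rintro ⟨s, t, hs, ht, hst, rfl⟩
    rw [cross_combination_left, cross_combination_right]
    exact ⟨by positivity, by positivity, by rw [← add_mul, hst, one_mul]⟩
  · rintro ⟨h1, h2, h3⟩
    refine ⟨_, _, div_nonneg h1 hD.le, div_nonneg h2 hD.le, ?_, (eq_combination hD x).symm⟩
    rw [← add_div, h3, div_self hD.ne']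

theorem mem_trapezoid {a b : Fin 2 → ℝ} (hD : 0 < cross a b) {x : Fin 2 → ℝ} :
    x ∈ segment ℝ 0 b + triangle a b ↔ (0 ≤ cross x b ∧ cross x b ≤ cross a b) ∧
      0 ≤ cross a x ∧ cross x b + cross a x ≤ 2 * cross a b := by
  constructor
  · rintro ⟨y, hy, z, hz, rfl⟩
    rw [mem_segment_zero_right hD] at hy
    rw [mem_triangle hD] at hz
    have e1 : cross (y + z) b = cross y b + cross z b := by simp [cross]; ring
    have e2 : cross a (y + z) = cross a y + cross a z := by simp [cross]; ring
    simp only [e1, e2]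
    refine ⟨⟨?_, ?_⟩, ?_, ?_⟩ <;> linarith
  · rintro ⟨⟨h1, h2⟩, h3, h4⟩
    -- The excess of `x` over the third side of the triangle; subtracting this much along `b` is the
    -- least shift that brings `x` under that side.
    set m := max 0 (cross x b + cross a x - cross a b) with hm
    have hm0 : 0 ≤ m := le_max_left _ _
    have hm1 : cross x b + cross a x - cross a b ≤ m := le_max_right _ _
    have hm2 : m ≤ cross a b := max_le hD.le (by linarith)
    have hm3 : m ≤ cross a x := max_le h3 (by linarith)
    have e1 : cross ((m / cross a b) • b) b = 0 := by simp [cross]; ring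
    have e2 : cross a ((m / cross a b) • b) = m := by
      have := cross_combination_right a b 0 (m / cross a b)
      rwa [zero_smul, zero_add, div_mul_cancel₀ _ hD.ne'] at this
    have e3 : ∀ y, cross (x - y) b = cross x b - cross y b := by intro y; simp [cross]; ring
    have e4 : ∀ y, cross a (x - y) = cross a x - cross a y := by intro y; simp [cross]; ring
    refine ⟨(m / cross a b) • b, ?_, x - (m / cross a b) • b, ?_, add_sub_cancel _ x⟩
    · rw [mem_segment_zero_right hD, e1, e2]
      exact ⟨rfl, hm0, hm2⟩
    · rw [mem_triangle hD, e3, e4, e1, e2]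
      refine ⟨?_, ?_, ?_⟩ <;> linarith

theorem dot_rot_right (b x : Fin 2 → ℝ) : x ⬝ᵥ rot b = cross x b := by
  rw [dot_eq]; simp [cross, rot]; ring

theorem dot_neg_rot_left (a x : Fin 2 → ℝ) : x ⬝ᵥ -rot a = cross a x := by
  rw [dot_eq]; simp [cross, rot]; ring

section Cuts

variable {a b : Fin 2 → ℝ}

theorem cross_neg_neg (a b : Fin 2 → ℝ) : cross (-a) (-b) = cross a b := by
  simp [cross]

/-- The cut runs along the diagonal from `a` to `b`; the far half is the point reflection of the
near one in the centre. -/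
theorem parallelogram_cut (hD : 0 < cross a b) :
    parallelogram a b ∩ {x | x ⬝ᵥ (rot b - rot a) ≤ cross a b} = triangle a b ∧
    parallelogram a b ∩ {x | cross a b ≤ x ⬝ᵥ (rot b - rot a)} =
      {a + b} + triangle (-a) (-b) ∧
    parallelogram a b ∩ {x | x ⬝ᵥ (rot b - rot a) = cross a b} = segment ℝ a b := by
  have hn : ∀ x : Fin 2 → ℝ, x ⬝ᵥ (rot b - rot a) = cross x b + cross a x := by
    intro x
    rw [sub_eq_add_neg, dotProduct_add, dot_rot_right, dot_neg_rot_left]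
  have hD' : 0 < cross (-a) (-b) := by rwa [cross_neg_neg]
  refine ⟨?_, ?_, ?_⟩ <;> ext x
  · rw [mem_inter_iff, mem_parallelogram hD, mem_triangle hD, mem_ofPred_eq, hn]
    constructor
    · rintro ⟨⟨⟨_, _⟩, _, _⟩, _⟩; exact ⟨by linarith, by linarith, by linarith⟩
    · rintro ⟨_, _, _⟩
      exact ⟨⟨⟨by linarith, by linarith⟩, by linarith, by linarith⟩, by linarith⟩
  · rw [mem_inter_iff, mem_parallelogram hD, mem_singleton_add_iff, mem_triangle hD',
      mem_ofPred_eq, hn, cross_neg_neg]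
    have e1 : cross (x - (a + b)) (-b) = cross a b - cross x b := by simp [cross]; ring
    have e2 : cross (-a) (x - (a + b)) = cross a b - cross a x := by simp [cross]; ring
    rw [e1, e2]
    constructor
    · rintro ⟨⟨⟨_, _⟩, _, _⟩, _⟩; exact ⟨by linarith, by linarith, by linarith⟩
    · rintro ⟨_, _, _⟩
      exact ⟨⟨⟨by linarith, by linarith⟩, by linarith, by linarith⟩, by linarith⟩
  · rw [mem_inter_iff, mem_parallelogram hD, mem_segment_of_cross hD, mem_ofPred_eq, hn]
    constructor
    · rintro ⟨⟨⟨_, _⟩, _, _⟩, _⟩; exact ⟨by linarith, by linarith, by linarith⟩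
    · rintro ⟨_, _, _⟩
      exact ⟨⟨⟨by linarith, by linarith⟩, by linarith, by linarith⟩, by linarith⟩

/-- The cut through `a` parallel to `b` splits off one translate of the triangle. The remaining
trapezoid is cut in `trapezoid_cut` through `b` parallel to `a`, into a parallelogram and a second
translate. -/
theorem triangle_two_smul_cut (hD : 0 < cross a b) :
    triangle ((2 : ℝ) • a) ((2 : ℝ) • b) ∩ {x | x ⬝ᵥ rot b ≤ cross a b} =
      segment ℝ 0 b + triangle a b ∧
    triangle ((2 : ℝ) • a) ((2 : ℝ) • b) ∩ {x | cross a b ≤ x ⬝ᵥ rot b} = {a} + triangle a b ∧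
    triangle ((2 : ℝ) • a) ((2 : ℝ) • b) ∩ {x | x ⬝ᵥ rot b = cross a b} =
      {a} + segment ℝ 0 b := by
  have e1 : ∀ x, cross x ((2 : ℝ) • b) = 2 * cross x b := fun x => by simp [cross]; ring
  have e2 : ∀ x, cross ((2 : ℝ) • a) x = 2 * cross a x := fun x => by simp [cross]; ring
  have hD' : 0 < cross ((2 : ℝ) • a) ((2 : ℝ) • b) := by rw [e1, e2]; linarith
  have e3 : ∀ x, cross (x - a) b = cross x b - cross a b := fun x => by simp [cross]; ring
  have e4 : ∀ x, cross a (x - a) = cross a x := fun x => by simp [cross]; ring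
  refine ⟨?_, ?_, ?_⟩ <;> ext x
  · rw [mem_inter_iff, mem_triangle hD', mem_trapezoid hD, mem_ofPred_eq, dot_rot_right]
    simp only [e1, e2]
    constructor
    · rintro ⟨⟨_, _, _⟩, _⟩
      exact ⟨⟨by linarith, by linarith⟩, by linarith, by linarith⟩
    · rintro ⟨⟨_, _⟩, _, _⟩
      exact ⟨⟨by linarith, by linarith, by linarith⟩, by linarith⟩
  · rw [mem_inter_iff, mem_triangle hD', mem_singleton_add_iff, mem_triangle hD, mem_ofPred_eq,
      dot_rot_right]
    simp only [e1, e2, e3, e4]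
    constructor
    · rintro ⟨⟨_, _, _⟩, _⟩; exact ⟨by linarith, by linarith, by linarith⟩
    · rintro ⟨_, _, _⟩; exact ⟨⟨by linarith, by linarith, by linarith⟩, by linarith⟩
  · rw [mem_inter_iff, mem_triangle hD', mem_singleton_add_iff, mem_segment_zero_right hD,
      mem_ofPred_eq, dot_rot_right]
    simp only [e1, e2, e3, e4]
    constructor
    · rintro ⟨⟨_, _, _⟩, _⟩; exact ⟨by linarith, by linarith, by linarith⟩
    · rintro ⟨_, _, _⟩; exact ⟨⟨by linarith, by linarith, by linarith⟩, by linarith⟩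

theorem trapezoid_cut (hD : 0 < cross a b) :
    (segment ℝ 0 b + triangle a b) ∩ {x | x ⬝ᵥ -rot a ≤ cross a b} = parallelogram a b ∧
    (segment ℝ 0 b + triangle a b) ∩ {x | cross a b ≤ x ⬝ᵥ -rot a} = {b} + triangle a b ∧
    (segment ℝ 0 b + triangle a b) ∩ {x | x ⬝ᵥ -rot a = cross a b} = {b} + segment ℝ 0 a := by
  have e3 : ∀ x, cross (x - b) b = cross x b := fun x => by simp [cross]; ring
  have e4 : ∀ x, cross a (x - b) = cross a x - cross a b := fun x => by simp [cross]; ring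
  refine ⟨?_, ?_, ?_⟩ <;> ext x
  · rw [mem_inter_iff, mem_trapezoid hD, mem_parallelogram hD, mem_ofPred_eq, dot_neg_rot_left]
    constructor
    · rintro ⟨⟨⟨_, _⟩, _, _⟩, _⟩
      exact ⟨⟨by linarith, by linarith⟩, by linarith, by linarith⟩
    · rintro ⟨⟨_, _⟩, _, _⟩
      exact ⟨⟨⟨by linarith, by linarith⟩, by linarith, by linarith⟩, by linarith⟩
  · rw [mem_inter_iff, mem_trapezoid hD, mem_singleton_add_iff, mem_triangle hD, mem_ofPred_eq,
      dot_neg_rot_left, e3, e4]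
    constructor
    · rintro ⟨⟨⟨_, _⟩, _, _⟩, _⟩; exact ⟨by linarith, by linarith, by linarith⟩
    · rintro ⟨_, _, _⟩
      exact ⟨⟨⟨by linarith, by linarith⟩, by linarith, by linarith⟩, by linarith⟩
  · rw [mem_inter_iff, mem_trapezoid hD, mem_singleton_add_iff, mem_segment_zero_left hD,
      mem_ofPred_eq, dot_neg_rot_left, e3, e4]
    constructor
    · rintro ⟨⟨⟨_, _⟩, _, _⟩, _⟩; exact ⟨by linarith, by linarith, by linarith⟩
    · rintro ⟨_, _, _⟩
      exact ⟨⟨⟨by linarith, by linarith⟩, by linarith, by linarith⟩, by linarith⟩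

end Cuts

/-! ### Translation-invariant cut-additive functionals on triangles -/

theorem triangle_latticePt (a b : Fin 2 → ℤ) :
    triangle (latticePt a) (latticePt b) = latticeHull {0, a, b} := by
  simp [triangle, latticeHull, image_insert_eq, latticePt_zero]

theorem segment_zero_latticePt (a : Fin 2 → ℤ) :
    segment ℝ 0 (latticePt a) = latticeHull {0, a} := by
  rw [latticeHull_pair, latticePt_zero]

theorem isLatticePolygon_triangle (a b : Fin 2 → ℤ) :
    IsLatticePolygon (triangle (latticePt a) (latticePt b)) := by
  rw [triangle_latticePt]; exact isLatticePolygon_latticeHull (Finset.insert_nonempty _ _)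

theorem isLatticePolygon_segment (a b : Fin 2 → ℤ) :
    IsLatticePolygon (segment ℝ (latticePt a) (latticePt b)) := by
  rw [← latticeHull_pair]; exact isLatticePolygon_latticeHull (Finset.insert_nonempty _ _)

theorem isLatticePolygon_segment_zero (a : Fin 2 → ℤ) :
    IsLatticePolygon (segment ℝ 0 (latticePt a)) := by
  rw [← latticePt_zero]; exact isLatticePolygon_segment 0 a

theorem isLatticePolygon_parallelogram (a b : Fin 2 → ℤ) :
    IsLatticePolygon (parallelogram (latticePt a) (latticePt b)) :=
  (isLatticePolygon_segment_zero a).add (isLatticePolygon_segment_zero b)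

theorem latticeHull_triangle (p q r : Fin 2 → ℤ) :
    latticeHull {p, q, r} = {latticePt p} + triangle (latticePt (q - p)) (latticePt (r - p)) := by
  rw [triangle_latticePt, ← latticeHull_singleton, latticeHull_add]
  congr 1
  simp [Finset.singleton_add, Finset.vadd_finset_insert, Finset.vadd_finset_singleton]

theorem latticeHull_pair_eq_add (p q : Fin 2 → ℤ) :
    latticeHull {p, q} = {latticePt p} + segment ℝ 0 (latticePt (q - p)) := by
  rw [segment_zero_latticePt, ← latticeHull_singleton, latticeHull_add]
  congr 1
  simp [Finset.singleton_add, Finset.vadd_finset_insert, Finset.vadd_finset_singleton]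

/-- Invariance under translations by lattice vectors. -/
def LatticeTranslationInvariant (Φ : Set (Fin 2 → ℝ) → ℝ) : Prop :=
  ∀ (p : Fin 2 → ℤ) (K : Set (Fin 2 → ℝ)), IsLatticePolygon K → Φ ({latticePt p} + K) = Φ K

namespace CutAdditive

variable {Φ : Set (Fin 2 → ℝ) → ℝ}

theorem parallelogram_eq (hΦ : CutAdditive Φ) (ht : LatticeTranslationInvariant Φ)
    (hs : ∀ a : Fin 2 → ℤ, Φ (segment ℝ 0 (latticePt a)) = 0) {a b : Fin 2 → ℤ}
    (hD : 0 < cross (latticePt a) (latticePt b)) :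
    Φ (parallelogram (latticePt a) (latticePt b)) =
      Φ (triangle (latticePt a) (latticePt b)) + Φ (triangle (latticePt (-a)) (latticePt (-b))) := by
  obtain ⟨h1, h2, h3⟩ := parallelogram_cut hD
  rw [← latticePt_add, ← latticePt_neg, ← latticePt_neg] at h2
  have ht2 := isLatticePolygon_triangle (-a) (-b)
  have := hΦ (parallelogram (latticePt a) (latticePt b)) _ _ (isLatticePolygon_parallelogram a b)
    (h1 ▸ isLatticePolygon_triangle a b)
    (h2 ▸ (IsLatticePolygon.singleton (a + b)).add ht2)
    (h3 ▸ isLatticePolygon_segment a b)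
  rw [h1, h2, h3, ht _ _ ht2, ← latticeHull_pair, latticeHull_pair_eq_add,
    ht _ _ (isLatticePolygon_segment_zero _), hs, add_zero] at this
  exact this

theorem triangle_two_smul_eq (hΦ : CutAdditive Φ) (ht : LatticeTranslationInvariant Φ)
    (hs : ∀ a : Fin 2 → ℤ, Φ (segment ℝ 0 (latticePt a)) = 0) {a b : Fin 2 → ℤ}
    (hD : 0 < cross (latticePt a) (latticePt b)) :
    Φ (triangle (latticePt (2 • a)) (latticePt (2 • b))) =
      2 * Φ (triangle (latticePt a) (latticePt b)) +
        Φ (parallelogram (latticePt a) (latticePt b)) := by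
  obtain ⟨h1, h2, h3⟩ := triangle_two_smul_cut hD
  obtain ⟨k1, k2, k3⟩ := trapezoid_cut hD
  have hT := isLatticePolygon_triangle a b
  have hZ := (isLatticePolygon_segment_zero b).add hT
  have e : ∀ x : Fin 2 → ℤ, latticePt (2 • x) = (2 : ℝ) • latticePt x := fun x => by
    rw [latticePt_nsmul]; norm_num
  rw [← e, ← e] at h1 h2 h3
  have c1 := hΦ _ _ _ (isLatticePolygon_triangle (2 • a) (2 • b)) (h1 ▸ hZ)
    (h2 ▸ (IsLatticePolygon.singleton a).add hT)
    (h3 ▸ (IsLatticePolygon.singleton a).add (isLatticePolygon_segment_zero b))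
  have c2 := hΦ _ _ _ hZ (k1 ▸ isLatticePolygon_parallelogram a b)
    (k2 ▸ (IsLatticePolygon.singleton b).add hT)
    (k3 ▸ (IsLatticePolygon.singleton b).add (isLatticePolygon_segment_zero a))
  rw [h1, h2, h3, ht _ _ hT, ht _ _ (isLatticePolygon_segment_zero b), hs] at c1
  rw [k1, k2, k3, ht _ _ hT, ht _ _ (isLatticePolygon_segment_zero a), hs] at c2
  linarith

end CutAdditive

/-- The two halves of the parallelogram are congruent by a point reflection. -/
theorem area_triangle {a b : Fin 2 → ℝ} (hD : 0 < cross a b) :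
    area (triangle a b) = cross a b / 2 := by
  obtain ⟨h1, h2, h3⟩ := parallelogram_cut hD
  have hB : IsBody (parallelogram a b) := (isBody_segment _ _).add (isBody_segment _ _)
  have := area_add_cut hB (IsBody.singleton 0) (rot b - rot a) (cross a b)
  rw [h1, h2, h3] at this
  simp only [singleton_zero, add_zero] at this
  have hneg : triangle (-a) (-b) = -triangle a b := by
    rw [triangle, triangle, ← convexHull_neg]
    congr 1
    ext x
    simp
  rw [area_singleton_add, hneg, area_neg, area_segment, parallelogram, area_parallelogram,
    abs_of_pos hD] at this
  linarith

/-! ### The mixed area formula -/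

/-- The error in the formula for the mixed area in terms of edges. -/
noncomputable def mixedAreaDefect (R K : Set (Fin 2 → ℝ)) : ℝ := mixedArea K R - edgeSum K (supportFun R)

theorem area_singleton (p : Fin 2 → ℝ) : area {p} = 0 := by
  simpa using area_segment p p

section Defect

variable {R : Set (Fin 2 → ℝ)}

theorem mixedAreaDefect_cutAdditive (hR : IsBody R) : CutAdditive (mixedAreaDefect R) := by
  intro K n c hK h1 h2 h3
  have e1 := area_add_cut hK.isBody hR n c
  have e2 := area_add_cut hK.isBody (IsBody.singleton 0) n c
  simp only [singleton_zero, add_zero] at e2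
  have e3 := edgeSum_cutAdditive (supportFun R) K n c hK h1 h2 h3
  simp only [mixedAreaDefect, mixedArea] at e3 ⊢
  linarith

theorem mixedAreaDefect_translationInvariant (R : Set (Fin 2 → ℝ)) :
    LatticeTranslationInvariant (mixedAreaDefect R) := by
  intro p K hK
  rw [mixedAreaDefect, mixedAreaDefect, mixedArea, mixedArea, add_assoc, area_singleton_add,
    area_singleton_add, (IsLatticePolygon.singleton p).edgeSum_add hK,
    IsLatticePolygon.edgeSum_singleton, zero_add]

theorem edgeSum_segment_zero (a : Fin 2 → ℤ) {φ : (Fin 2 → ℝ) → ℝ} (hφ : PosHomogeneous φ) :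
    edgeSum (segment ℝ 0 (latticePt a)) φ = φ (rot (latticePt a)) + φ (-rot (latticePt a)) := by
  rcases eq_or_ne 0 a with rfl | ha
  · have h0 : φ 0 = 0 := by simpa using hφ 0 le_rfl 0
    have : rot 0 = 0 := plane_ext (by simp [rot]) (by simp [rot])
    rw [latticePt_zero, segment_same, IsLatticePolygon.edgeSum_singleton, this, neg_zero, h0,
      add_zero]
  · obtain ⟨d, v, hd, -, hrot, hsum⟩ := edgeSum_pair ha
    have hd' : (0 : ℝ) ≤ d := by exact_mod_cast hd.le
    rw [latticePt_zero, sub_zero] at hrot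
    rw [segment_zero_latticePt, hsum, hrot, ← smul_neg, hφ _ hd', hφ _ hd']

theorem mixedAreaDefect_segment (hR : IsBody R) (a : Fin 2 → ℤ) :
    mixedAreaDefect R (segment ℝ 0 (latticePt a)) = 0 := by
  rw [mixedAreaDefect, mixedArea, area_segment_add hR, area_segment,
    edgeSum_segment_zero a hR.posHomogeneous]
  ring

/-- The parallelogram is added to `R` one segment at a time, and `area_segment_add` is exact for
each. -/
theorem mixedAreaDefect_parallelogram (hR : IsBody R) (a b : Fin 2 → ℤ) :
    mixedAreaDefect R (parallelogram (latticePt a) (latticePt b)) = 0 := by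
  have hb := isBody_segment 0 (latticePt b)
  rw [mixedAreaDefect, mixedArea, parallelogram, add_assoc, area_segment_add (hb.add hR),
    area_segment_add hR, area_segment_add hb, area_segment, hb.supportFun_add hR,
    hb.supportFun_add hR, (isLatticePolygon_segment_zero a).edgeSum_add
    (isLatticePolygon_segment_zero b), edgeSum_segment_zero a hR.posHomogeneous,
    edgeSum_segment_zero b hR.posHomogeneous]
  ring

theorem edgeSum_triangle_zero {a b : Fin 2 → ℤ} (hD : 0 < cross (latticePt a) (latticePt b))
    {φ : (Fin 2 → ℝ) → ℝ} (hφ : PosHomogeneous φ) :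
    edgeSum (triangle (latticePt a) (latticePt b)) φ = φ (rot (latticePt a)) +
      φ (rot (latticePt b - latticePt a)) + φ (-rot (latticePt b)) := by
  rw [triangle_latticePt, edgeSum_triangle _ hφ, latticePt_zero, sub_zero, zero_sub, rot_neg]
  rw [triangleDet, latticePt_zero, sub_zero, sub_zero]
  exact hD

theorem latticePt_two_pow_nsmul (k : ℕ) (x : Fin 2 → ℤ) :
    latticePt (2 ^ k • x) = (2 : ℝ) ^ k • latticePt x := by
  rw [latticePt_nsmul]; norm_num

theorem cross_two_pow_pos {a b : Fin 2 → ℤ} (hD : 0 < cross (latticePt a) (latticePt b)) (k : ℕ) :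
    0 < cross (latticePt (2 ^ k • a)) (latticePt (2 ^ k • b)) := by
  have : cross (latticePt (2 ^ k • a)) (latticePt (2 ^ k • b)) =
      ((2 ^ k : ℕ) : ℝ) ^ 2 * cross (latticePt a) (latticePt b) := by
    rw [latticePt_nsmul, latticePt_nsmul]; simp [cross]; ring
  rw [this]
  positivity

theorem mixedAreaDefect_triangle_two_pow (hR : IsBody R) {a b : Fin 2 → ℤ}
    (hD : 0 < cross (latticePt a) (latticePt b)) (k : ℕ) :
    mixedAreaDefect R (triangle (latticePt (2 ^ k • a)) (latticePt (2 ^ k • b))) =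
      2 ^ k * mixedAreaDefect R (triangle (latticePt a) (latticePt b)) := by
  induction k with
  | zero => simp
  | succ k ih =>
    have hD' := cross_two_pow_pos hD k
    rw [pow_succ', mul_smul, mul_smul,
      (mixedAreaDefect_cutAdditive hR).triangle_two_smul_eq
        (mixedAreaDefect_translationInvariant R) (mixedAreaDefect_segment hR) hD',
      mixedAreaDefect_parallelogram hR, ih, pow_succ']
    ring

/-- A translated and scaled triangle circumscribed to the sum of a triangle and a convex body. -/
theorem triangle_smul_add_subset (hR : IsBody R) {a b : Fin 2 → ℝ} (hD : 0 < cross a b) {c : ℝ}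
    (hc : 0 < c) : ∃ s, triangle (c • a) (c • b) + R ⊆ {s} + (c + (supportFun R (rot a) +
      supportFun R (rot (b - a)) + supportFun R (-rot b)) / cross a b) • triangle a b := by
  set h1 := supportFun R (rot a)
  set h2 := supportFun R (-rot b)
  set h3 := supportFun R (rot (b - a))
  -- The common vertex of the supporting lines of `R` parallel to `a` and to `b`: its coordinates
  -- are the lower bounds `-h2` of `cross r b` and `-h1` of `cross a r`.
  set s := (-h2 / cross a b) • a + (-h1 / cross a b) • b with hs
  have hY : ∀ r ∈ R, -h1 ≤ cross a r := by
    intro r hr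
    have := hR.le_supportFun hr (rot a)
    have e := dot_neg_rot_left a r
    rw [dotProduct_neg] at e
    linarith
  have hX : ∀ r ∈ R, -h2 ≤ cross r b := by
    intro r hr
    have := hR.le_supportFun hr (-rot b)
    rw [dotProduct_neg, dot_rot_right] at this
    linarith
  have hXY : ∀ r ∈ R, cross r b + cross a r ≤ h3 := by
    intro r hr
    have := hR.le_supportFun hr (rot (b - a))
    rw [dot_rot_right] at this
    have e : cross r (b - a) = cross r b + cross a r := by simp [cross]; ring
    linarith
  have hlam : 0 ≤ (h1 + h3 + h2) / cross a b := by
    obtain ⟨r, hr⟩ := hR.nonempty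
    refine div_nonneg ?_ hD.le
    linarith [hY r hr, hX r hr, hXY r hr]
  set c' := c + (h1 + h3 + h2) / cross a b with hc'
  have hc'0 : 0 < c' := by linarith
  have hc'D : c' * cross a b = c * cross a b + (h1 + h3 + h2) := by
    rw [hc']; field_simp
  have hsX : cross s b = -h2 := by
    rw [hs, cross_combination_left, div_mul_cancel₀ _ hD.ne']
  have hsY : cross a s = -h1 := by
    rw [hs, cross_combination_right, div_mul_cancel₀ _ hD.ne']
  refine ⟨s, ?_⟩
  rintro _ ⟨t, ht, r, hr, rfl⟩
  have e1 : ∀ x, cross x (c • b) = c * cross x b := fun x => by simp [cross]; ring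
  have e2 : ∀ x, cross (c • a) x = c * cross a x := fun x => by simp [cross]; ring
  have e3 : cross (t + r - s) b = cross t b + cross r b - cross s b := by simp [cross]; ring
  have e4 : cross a (t + r - s) = cross a t + cross a r - cross a s := by simp [cross]; ring
  have e5 : ∀ x, cross (c'⁻¹ • x) b = c'⁻¹ * cross x b := fun x => by simp [cross]; ring
  have e6 : ∀ x, cross a (c'⁻¹ • x) = c'⁻¹ * cross a x := fun x => by simp [cross]; ring
  rw [mem_triangle (by rw [e1, e2]; positivity)] at ht
  simp only [e1, e2] at ht
  obtain ⟨t1, t2, t3⟩ := ht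
  have t1' := nonneg_of_mul_nonneg_right t1 hc
  have t2' := nonneg_of_mul_nonneg_right t2 hc
  have t3' : cross t b + cross a t ≤ c * cross a b := by
    refine le_of_mul_le_mul_left ?_ hc
    linarith
  rw [mem_singleton_add_iff, mem_smul_set_iff_inv_smul_mem₀ hc'0.ne', mem_triangle hD, e5, e6,
    e3, e4, hsX, hsY]
  have hr1 := hX r hr
  have hr2 := hY r hr
  have hr3 := hXY r hr
  refine ⟨mul_nonneg (inv_nonneg.2 hc'0.le) (by linarith),
    mul_nonneg (inv_nonneg.2 hc'0.le) (by linarith), ?_⟩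
  rw [← mul_add, inv_mul_le_iff₀ hc'0, hc'D]
  linarith

theorem mixedAreaDefect_triangle_nonpos (hR : IsBody R) {a b : Fin 2 → ℤ}
    (hD : 0 < cross (latticePt a) (latticePt b)) :
    mixedAreaDefect R (triangle (latticePt a) (latticePt b)) ≤ 0 := by
  set A := latticePt a
  set B := latticePt b
  set D := cross A B with hDdef
  set M := edgeSum (triangle A B) (supportFun R) with hM
  have hMeq := edgeSum_triangle_zero hD hR.posHomogeneous
  rw [← hM] at hMeq
  set m := mixedAreaDefect R (triangle A B) with hm
  -- The mixed area of `R` with the triangle scaled by `2 ^ k` is `2 ^ k * (m + M)`. The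
  -- circumscribed triangle has area `(2 ^ k + M / D) ^ 2 * (D / 2)`, which exceeds that of the
  -- scaled triangle by `2 ^ k * M` and the constant `M ^ 2 / (2 * D)`.
  have key : m + M ≤ M := by
    refine le_of_forall_two_pow (c := M ^ 2 / (2 * D) - area R) fun k => ?_
    have hc : (0 : ℝ) < 2 ^ k := by positivity
    obtain ⟨s, hsub⟩ := triangle_smul_add_subset hR hD hc
    rw [← hMeq] at hsub
    have hTB : IsBody (triangle A B) := (isLatticePolygon_triangle a b).isBody
    have harea := area_mono_of_isCompact
      ((IsBody.singleton s).add (hTB.smul (2 ^ k + M / D))).compact hsub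
    rw [area_singleton_add, area_smul, area_triangle hD] at harea
    have e := latticePt_two_pow_nsmul k
    have h2 := mixedAreaDefect_triangle_two_pow hR hD k
    have hcross : cross (latticePt (2 ^ k • a)) (latticePt (2 ^ k • b)) = 2 ^ k * (2 ^ k * D) := by
      rw [e, e, hDdef]; simp [cross, A, B]; ring
    have hD' : 0 < cross (latticePt (2 ^ k • a)) (latticePt (2 ^ k • b)) := by
      rw [hcross]; positivity
    rw [mixedAreaDefect, mixedArea, area_triangle hD', hcross,
      edgeSum_triangle_zero hD' hR.posHomogeneous, e, e, ← smul_sub, rot_smul, rot_smul, rot_smul,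
      ← smul_neg, hR.supportFun_smul hc.le, hR.supportFun_smul hc.le, hR.supportFun_smul hc.le]
      at h2
    have h3 : (2 ^ k + M / D) ^ 2 * (D / 2) = 2 ^ k * (2 ^ k * D) / 2 + 2 ^ k * M +
        M ^ 2 / (2 * D) := by field_simp; ring
    rw [← hDdef, h3] at harea
    have h4 : 2 ^ k * M = 2 ^ k * supportFun R (rot A) + 2 ^ k * supportFun R (rot (B - A)) +
        2 ^ k * supportFun R (-rot B) := by rw [hMeq]; ring
    change _ = 2 ^ k * m at h2
    change area (triangle (2 ^ k • A) (2 ^ k • B) + R) - _ - _ - (2 ^ k * supportFun R (rot A) +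
      2 ^ k * supportFun R (rot (B - A)) + 2 ^ k * supportFun R (-rot B)) = _ at h2
    linarith
  linarith

/-- The mixed area of a lattice polygon and a convex body as a sum over the edges of the polygon. -/
theorem IsLatticePolygon.mixedArea_eq {P : Set (Fin 2 → ℝ)} (hP : IsLatticePolygon P)
    (hR : IsBody R) : mixedArea P R = edgeSum P (supportFun R) := by
  have hcut := mixedAreaDefect_cutAdditive hR
  have ht := mixedAreaDefect_translationInvariant R
  refine sub_eq_zero.1 (hcut.eq_zero (fun p q => ?_) (fun p q r h => ?_) hP)
  · rw [latticeHull_pair_eq_add, ht _ _ (isLatticePolygon_segment_zero _),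
      mixedAreaDefect_segment hR]
  · rw [latticeHull_triangle, ht _ _ (isLatticePolygon_triangle _ _)]
    have hD : 0 < cross (latticePt (q - p)) (latticePt (r - p)) := by
      rwa [latticePt_sub, latticePt_sub]
    have hD' : 0 < cross (latticePt (-(q - p))) (latticePt (-(r - p))) := by
      rwa [latticePt_neg, latticePt_neg, cross_neg_neg]
    have h1 := mixedAreaDefect_triangle_nonpos hR hD
    have h2 := mixedAreaDefect_triangle_nonpos hR hD'
    -- The triangle and its reflection have nonpositive defects with sum zero.
    have h3 := hcut.parallelogram_eq ht (mixedAreaDefect_segment hR) hD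
    rw [mixedAreaDefect_parallelogram hR] at h3
    linarith

end Defect

/-! ### Lattice point counts and Pick's formula -/

theorem finite_latticePt_mem {K : Set (Fin 2 → ℝ)} (hK : IsCompact K) :
    {z : Fin 2 → ℤ | latticePt z ∈ K}.Finite := by
  obtain ⟨C, hC⟩ := hK.isBounded.exists_norm_le
  refine (finite_Icc (fun _ : Fin 2 => -⌈C⌉) (fun _ => ⌈C⌉)).subset fun z hz => ?_
  have h : ∀ i, |(z i : ℝ)| ≤ C := fun i => (norm_le_pi_norm (latticePt z) i).trans (hC _ hz)
  have h' : ∀ i, |z i| ≤ ⌈C⌉ := fun i => by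
    have := (h i).trans (Int.le_ceil C)
    exact_mod_cast this
  exact ⟨fun i => (abs_le.1 (h' i)).1, fun i => (abs_le.1 (h' i)).2⟩

theorem latticeCount_cut {K : Set (Fin 2 → ℝ)} (hK : IsCompact K) (n : Fin 2 → ℝ) (c : ℝ) :
    latticeCount K + latticeCount (K ∩ {x | x ⬝ᵥ n = c}) =
      latticeCount (K ∩ {x | x ⬝ᵥ n ≤ c}) + latticeCount (K ∩ {x | c ≤ x ⬝ᵥ n}) := by
  have hfin := finite_latticePt_mem hK
  have h := ncard_union_add_ncard_inter {z : Fin 2 → ℤ | latticePt z ∈ K ∩ {x | x ⬝ᵥ n ≤ c}}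
    {z : Fin 2 → ℤ | latticePt z ∈ K ∩ {x | c ≤ x ⬝ᵥ n}} (hfin.subset fun z hz => hz.1)
    (hfin.subset fun z hz => hz.1)
  rw [latticeCount, latticeCount, latticeCount, latticeCount, ← h]
  congr 2
  · ext z
    simp only [mem_ofPred_eq, mem_inter_iff, mem_union, ← and_or_left]
    exact (and_iff_left (le_total _ _)).symm
  · ext z
    simp only [mem_ofPred_eq, mem_inter_iff]
    constructor
    · rintro ⟨h1, h2⟩; exact ⟨⟨h1, h2.le⟩, h1, h2.ge⟩
    · rintro ⟨⟨h1, h2⟩, -, h3⟩; exact ⟨h1, le_antisymm h2 h3⟩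

theorem latticeCount_singleton_add (p : Fin 2 → ℤ) (K : Set (Fin 2 → ℝ)) :
    latticeCount ({latticePt p} + K) = latticeCount K := by
  rw [latticeCount, latticeCount,
    ← ncard_image_of_injective {z | latticePt z ∈ K} (add_right_injective p)]
  congr 1
  ext z
  rw [mem_ofPred_eq, mem_singleton_add_iff, ← latticePt_sub]
  constructor
  · intro h; exact ⟨z - p, h, add_sub_cancel p z⟩
  · rintro ⟨y, hy, rfl⟩; simpa using hy

theorem latticeCount_neg (K : Set (Fin 2 → ℝ)) : latticeCount (-K) = latticeCount K := by
  rw [latticeCount, latticeCount,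
    ← ncard_image_of_injective {z | latticePt z ∈ K} (neg_injective (G := Fin 2 → ℤ))]
  congr 1
  ext z
  rw [mem_ofPred_eq, Set.mem_neg, ← latticePt_neg]
  constructor
  · intro h; exact ⟨-z, h, neg_neg z⟩
  · rintro ⟨y, hy, rfl⟩; simpa using hy

theorem supportFun_neg (K : Set (Fin 2 → ℝ)) (v : Fin 2 → ℝ) :
    supportFun (-K) v = supportFun K (-v) := by
  rw [supportFun, supportFun]
  congr 1
  ext t
  constructor
  · rintro ⟨x, hx, rfl⟩
    exact ⟨-x, hx, by simp only [neg_dotProduct, dotProduct_neg, neg_neg]⟩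
  · rintro ⟨x, hx, rfl⟩
    exact ⟨-x, by simpa using hx, by simp only [neg_dotProduct, dotProduct_neg]⟩

theorem face_neg (K : Set (Fin 2 → ℝ)) (v : Fin 2 → ℝ) : face (-K) v = -face K (-v) := by
  ext x
  rw [Set.mem_neg]
  simp only [face, mem_ofPred_eq, supportFun_neg, Set.mem_neg, neg_dotProduct, dotProduct_neg,
    neg_neg]

theorem edgeLength_neg (K : Set (Fin 2 → ℝ)) (v : Fin 2 → ℝ) :
    edgeLength (-K) v = edgeLength K (-v) := by
  rw [edgeLength, edgeLength, face_neg, supportFun_neg, supportFun_neg, rot_neg, neg_neg, add_comm,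
    neg_dotProduct, dotProduct_neg, neg_neg]

theorem edgeSum_neg (K : Set (Fin 2 → ℝ)) (φ : (Fin 2 → ℝ) → ℝ) :
    edgeSum (-K) φ = edgeSum K fun v => φ (-v) := by
  refine finsum_mem_eq_of_bijOn Neg.neg ⟨?_, neg_injective.injOn, ?_⟩ ?_
  · intro v hv
    exact IsCoprime.neg_neg hv
  · intro v hv
    exact ⟨-v, IsCoprime.neg_neg hv, neg_neg v⟩
  · intro v _
    simp only [edgeLength_neg, latticePt_neg, neg_neg]

/-- The lattice points are the multiples of the primitive vector `(-v 1, v 0)` by the integers from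
`0` to `d`; both ends count. -/
theorem latticeCount_segment {a v : Fin 2 → ℤ} {d : ℤ} (hd : 0 < d) (hv : IsCoprime (v 0) (v 1))
    (h1 : a 1 = d * v 0) (h0 : -a 0 = d * v 1) :
    (latticeCount (segment ℝ 0 (latticePt a)) : ℤ) = d + 1 := by
  have hd' : (0 : ℝ) < d := by exact_mod_cast hd
  have hset : {z : Fin 2 → ℤ | latticePt z ∈ segment ℝ 0 (latticePt a)} =
      (fun k : ℤ => (![-(k * v 1), k * v 0] : Fin 2 → ℤ)) '' (Finset.Icc 0 d : Finset ℤ) := by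
    ext z
    rw [mem_ofPred_eq, segment_zero_eq]
    constructor
    · rintro ⟨t, ht0, ht1, hz⟩
      have z0 : (z 0 : ℝ) = t * a 0 := congrFun hz 0
      have z1 : (z 1 : ℝ) = t * a 1 := congrFun hz 1
      have a0 : -(a 0 : ℝ) = d * v 1 := by exact_mod_cast h0
      have a1 : (a 1 : ℝ) = d * v 0 := by exact_mod_cast h1
      obtain ⟨k, hk1, hk0⟩ := exists_rot_eq_zsmul (e := z) hv (by
        have : (z 0 : ℝ) * v 0 + z 1 * v 1 = 0 := by
          rw [z0, z1]; linear_combination (-t * v 0) * a0 + t * v 1 * a1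
        exact_mod_cast this)
      have k1 : (z 1 : ℝ) = k * v 0 := by exact_mod_cast hk1
      have k0 : -(z 0 : ℝ) = k * v 1 := by exact_mod_cast hk0
      have hk : (k : ℝ) = t * d := by
        obtain ⟨α, β, hαβ⟩ := hv
        have hαβ' : (α : ℝ) * v 0 + β * v 1 = 1 := by exact_mod_cast hαβ
        have e0 : ((k : ℝ) - t * d) * v 0 = 0 := by
          linear_combination z1 - k1 + t * a1
        have e1 : ((k : ℝ) - t * d) * v 1 = 0 := by
          linear_combination -z0 - k0 + t * a0
        have : ((k : ℝ) - t * d) * 1 = 0 := by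
          rw [← hαβ']; linear_combination α * e0 + β * e1
        linarith
      refine ⟨k, ?_, ?_⟩
      · rw [Finset.mem_coe, Finset.mem_Icc]
        have l1 : (0 : ℝ) ≤ k := by rw [hk]; positivity
        have l2 : (k : ℝ) ≤ d := by rw [hk]; nlinarith
        exact ⟨by exact_mod_cast l1, by exact_mod_cast l2⟩
      · ext i
        fin_cases i
        · show -(k * v 1) = z 0
          omega
        · exact hk1.symm
    · rintro ⟨k, hk, rfl⟩
      rw [Finset.mem_coe, Finset.mem_Icc] at hk
      have l1 : (0 : ℝ) ≤ k := by exact_mod_cast hk.1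
      have l2 : (k : ℝ) ≤ d := by exact_mod_cast hk.2
      have a0 : -(a 0 : ℝ) = d * v 1 := by exact_mod_cast h0
      have a1 : (a 1 : ℝ) = d * v 0 := by exact_mod_cast h1
      refine ⟨k / d, by positivity, (div_le_one hd').2 l2, plane_ext ?_ ?_⟩
      · simp only [latticePt, Matrix.cons_val_zero, Pi.smul_apply, smul_eq_mul]
        push_cast
        field_simp
        linear_combination k * a0
      · simp only [latticePt, Matrix.cons_val_one, Matrix.cons_val_fin_one, Pi.smul_apply,
          smul_eq_mul]
        push_cast
        field_simp
        linear_combination (-(k : ℝ)) * a1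
  have hinj : Function.Injective fun k : ℤ => (![-(k * v 1), k * v 0] : Fin 2 → ℤ) := by
    intro k l hkl
    have e0 : -(k * v 1) = -(l * v 1) := congrFun hkl 0
    have e1 : k * v 0 = l * v 0 := congrFun hkl 1
    obtain ⟨α, β, hαβ⟩ := hv
    linear_combination (l - k) * hαβ + α * e1 - β * e0
  rw [latticeCount, hset, ncard_image_of_injective _ hinj, ncard_coe_finset, Int.card_Icc]
  omega

/-- The error in Pick's formula. -/
noncomputable def pickDefect (K : Set (Fin 2 → ℝ)) : ℝ :=
  2 * latticeCount K - 2 * area K - edgeSum K (fun _ => 1) - 2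

theorem pickDefect_cutAdditive : CutAdditive pickDefect := by
  intro K n c hK h1 h2 h3
  have e1 : (latticeCount K : ℝ) + latticeCount (K ∩ {x | x ⬝ᵥ n = c}) =
      latticeCount (K ∩ {x | x ⬝ᵥ n ≤ c}) + latticeCount (K ∩ {x | c ≤ x ⬝ᵥ n}) := by
    exact_mod_cast latticeCount_cut hK.isBody.compact n c
  have e2 := area_add_cut hK.isBody (IsBody.singleton 0) n c
  simp only [singleton_zero, add_zero] at e2
  have e3 := edgeSum_cutAdditive (fun _ => 1) K n c hK h1 h2 h3
  simp only [pickDefect] at e3 ⊢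
  linarith

theorem pickDefect_translationInvariant : LatticeTranslationInvariant pickDefect := by
  intro p K hK
  rw [pickDefect, pickDefect, latticeCount_singleton_add, area_singleton_add,
    (IsLatticePolygon.singleton p).edgeSum_add hK, IsLatticePolygon.edgeSum_singleton, zero_add]

theorem pickDefect_segment (a : Fin 2 → ℤ) : pickDefect (segment ℝ 0 (latticePt a)) = 0 := by
  rw [pickDefect, area_segment]
  rcases eq_or_ne 0 a with rfl | ha
  · have : latticeCount {latticePt 0} = 1 := by
      rw [latticeCount, ← ncard_singleton (0 : Fin 2 → ℤ)]
      congr 1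
      ext z
      exact latticePt_injective.eq_iff
    rw [← latticePt_zero, segment_same, IsLatticePolygon.edgeSum_singleton, this]
    norm_num
  · obtain ⟨d, v, hd, hv, hrot, hsum⟩ := edgeSum_pair ha
    rw [latticePt_zero, sub_zero] at hrot
    have h1 : a 1 = d * v 0 := by
      have : (a 1 : ℝ) = d * v 0 := congrFun hrot 0
      exact_mod_cast this
    have h0 : -a 0 = d * v 1 := by
      have : -(a 0 : ℝ) = d * v 1 := congrFun hrot 1
      exact_mod_cast this
    have hc : (latticeCount (segment ℝ 0 (latticePt a)) : ℝ) = d + 1 := by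
      exact_mod_cast latticeCount_segment hd hv h1 h0
    rw [hc, segment_zero_latticePt, hsum]
    ring

theorem triangle_neg (a b : Fin 2 → ℝ) : triangle (-a) (-b) = -triangle a b := by
  rw [triangle, triangle, ← convexHull_neg]
  congr 1
  ext x
  simp

theorem triangle_smul (c : ℝ) (a b : Fin 2 → ℝ) :
    triangle (c • a) (c • b) = c • triangle a b := by
  rw [triangle, triangle, ← convexHull_smul, smul_set_insert, smul_set_insert, smul_set_singleton,
    smul_zero]

theorem pickDefect_neg (K : Set (Fin 2 → ℝ)) : pickDefect (-K) = pickDefect K := by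
  rw [pickDefect, pickDefect, latticeCount_neg, area_neg, edgeSum_neg]

/-- The parallelogram in the doubled triangle has twice the defect of the triangle, by invariance
under reflection; with the two translates this gives the factor 4. -/
theorem pickDefect_triangle_two_pow {a b : Fin 2 → ℤ}
    (hD : 0 < cross (latticePt a) (latticePt b)) (k : ℕ) :
    pickDefect (triangle (latticePt (2 ^ k • a)) (latticePt (2 ^ k • b))) =
      4 ^ k * pickDefect (triangle (latticePt a) (latticePt b)) := by
  induction k with
  | zero => simp
  | succ k ih =>
    have hD' := cross_two_pow_pos hD k
    rw [pow_succ', mul_smul, mul_smul,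
      pickDefect_cutAdditive.triangle_two_smul_eq pickDefect_translationInvariant
        pickDefect_segment hD',
      pickDefect_cutAdditive.parallelogram_eq pickDefect_translationInvariant
        pickDefect_segment hD', latticePt_neg, latticePt_neg, triangle_neg, pickDefect_neg, ih,
      pow_succ']
    ring

theorem edgeSum_triangle_two_pow (a b : Fin 2 → ℤ) (φ : (Fin 2 → ℝ) → ℝ) (k : ℕ) :
    edgeSum (triangle (latticePt (2 ^ k • a)) (latticePt (2 ^ k • b))) φ =
      2 ^ k * edgeSum (triangle (latticePt a) (latticePt b)) φ := by
  induction k with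
  | zero => simp
  | succ k ih =>
    have hT := isLatticePolygon_triangle (2 ^ k • a) (2 ^ k • b)
    have h2 : triangle (latticePt (2 ^ (k + 1) • a)) (latticePt (2 ^ (k + 1) • b)) =
        triangle (latticePt (2 ^ k • a)) (latticePt (2 ^ k • b)) +
          triangle (latticePt (2 ^ k • a)) (latticePt (2 ^ k • b)) := by
      rw [pow_succ', mul_smul, mul_smul, latticePt_nsmul 2, latticePt_nsmul 2, triangle_smul]
      have := hT.isBody.convex.add_smul (p := 1) (q := 1) zero_le_one zero_le_one
      rw [one_smul] at this
      rw [← this]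
      norm_num
    rw [h2, hT.edgeSum_add hT, ih, pow_succ']
    ring

/-- Rewrites the count in a dilate as a count of points of the refined lattice, the form required by
`tendsto_card_div_pow_atTop_volume`. -/
theorem latticeCount_nat_smul {n : ℕ} (hn : n ≠ 0) (s : Set (Fin 2 → ℝ)) :
    latticeCount ((n : ℝ) • s) = Nat.card ↑(s ∩ (n : ℝ)⁻¹ •
      (Submodule.span ℤ (range (Pi.basisFun ℝ (Fin 2))) : Set (Fin 2 → ℝ))) := by
  have hn' : (n : ℝ) ≠ 0 := by exact_mod_cast hn
  have hinj : Function.Injective fun z : Fin 2 → ℤ => (n : ℝ)⁻¹ • latticePt z :=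
    (smul_right_injective _ (inv_ne_zero hn')).comp latticePt_injective
  have hL : ∀ x : Fin 2 → ℝ, x ∈ (Submodule.span ℤ (range (Pi.basisFun ℝ (Fin 2))) :
      Set (Fin 2 → ℝ)) ↔ ∃ z, latticePt z = x := by
    intro x
    rw [SetLike.mem_coe, (Pi.basisFun ℝ (Fin 2)).mem_span_iff_repr_mem ℤ]
    constructor
    · intro h
      choose z hz using h
      refine ⟨z, funext fun i => ?_⟩
      simpa [latticePt] using hz i
    · rintro ⟨z, rfl⟩ i
      exact ⟨z i, by simp [latticePt]⟩
  rw [Nat.card_coe_set_eq, latticeCount, ← ncard_image_of_injective _ hinj]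
  congr 1
  ext x
  rw [mem_inter_iff, mem_inv_smul_set_iff₀ hn', hL]
  constructor
  · rintro ⟨z, hz, rfl⟩
    refine ⟨(mem_smul_set_iff_inv_smul_mem₀ hn' _ _).1 hz, z, ?_⟩
    rw [smul_inv_smul₀ hn']
  · rintro ⟨hx, z, hz⟩
    refine ⟨z, ?_, ?_⟩
    · rw [mem_ofPred_eq, hz]
      exact smul_mem_smul_set hx
    · simp only [hz]
      rw [inv_smul_smul₀ hn']

/-- The defect of the triangle scaled by `2 ^ k`, divided by `4 ^ k`, is constant in `k`. It tends
to zero, since the normalised count tends to the area while the edge sum and the constant 2 become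
negligible. -/
theorem pickDefect_triangle {a b : Fin 2 → ℤ} (hD : 0 < cross (latticePt a) (latticePt b)) :
    pickDefect (triangle (latticePt a) (latticePt b)) = 0 := by
  set T := triangle (latticePt a) (latticePt b) with hT
  have hB : IsBody T := (isLatticePolygon_triangle a b).isBody
  have hlim := (tendsto_card_div_pow_atTop_volume T hB.compact.isBounded hB.compact.measurableSet
    (hB.convex.addHaar_frontier volume)).comp
    (tendsto_pow_atTop_atTop_of_one_lt (one_lt_two : (1 : ℕ) < 2))
  have h2 : Tendsto (fun k : ℕ => ((1 : ℝ) / 2) ^ k) atTop (𝓝 0) :=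
    tendsto_pow_atTop_nhds_zero_of_lt_one (by norm_num) (by norm_num)
  have h4 : Tendsto (fun k : ℕ => ((1 : ℝ) / 4) ^ k) atTop (𝓝 0) :=
    tendsto_pow_atTop_nhds_zero_of_lt_one (by norm_num) (by norm_num)
  have htot := (((hlim.const_mul 2).sub_const (2 * area T)).sub
    (h2.mul_const (edgeSum T fun _ => 1))).sub (h4.mul_const 2)
  have hzero : 2 * volume.real T - 2 * area T - 0 * (edgeSum T fun _ => 1) - 0 * 2 = 0 := by
    rw [area, Measure.real]; ring
  rw [hzero] at htot
  refine tendsto_nhds_unique (tendsto_const_nhds.congr fun k => ?_) htot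
  have h := pickDefect_triangle_two_pow hD k
  have hsm : triangle (latticePt (2 ^ k • a)) (latticePt (2 ^ k • b)) = ((2 ^ k : ℕ) : ℝ) • T := by
    rw [latticePt_nsmul, latticePt_nsmul, triangle_smul]
  rw [pickDefect, edgeSum_triangle_two_pow, hsm, latticeCount_nat_smul (by positivity),
    area_smul, ← hT] at h
  have h4k : (4 : ℝ) ^ k = 2 ^ k * 2 ^ k := by rw [← mul_pow]; norm_num
  have hpos : (0 : ℝ) < 2 ^ k := by positivity
  simp only [Function.comp_apply, Fintype.card_fin, one_div, inv_pow]
  rw [h4k] at h ⊢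
  push_cast at h ⊢
  generalize Nat.card _ = N at h ⊢
  field_simp
  linarith

/-- Pick's theorem for lattice polygons, including degenerate ones. -/
theorem IsLatticePolygon.pick {P : Set (Fin 2 → ℝ)} (hP : IsLatticePolygon P) :
    2 * (latticeCount P : ℝ) = 2 * area P + edgeSum P (fun _ => 1) + 2 := by
  have : pickDefect P = 0 := by
    refine pickDefect_cutAdditive.eq_zero (fun p q => ?_) (fun p q r h => ?_) hP
    · rw [latticeHull_pair_eq_add, pickDefect_translationInvariant _ _
        (isLatticePolygon_segment_zero _), pickDefect_segment]
    · rw [latticeHull_triangle, pickDefect_translationInvariant _ _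
        (isLatticePolygon_triangle _ _)]
      refine pickDefect_triangle ?_
      rwa [latticePt_sub, latticePt_sub]
  rw [pickDefect] at this
  linarith

/-! ### Positivity of the mixed area -/

theorem IsBody.mixedArea_self {P : Set (Fin 2 → ℝ)} (hP : IsBody P) :
    mixedArea P P = 2 * area P := by
  have := hP.convex.add_smul (p := 1) (q := 1) zero_le_one zero_le_one
  rw [one_smul] at this
  rw [mixedArea, ← this, area_smul]
  ring

/-- The mixed area with a body with interior points is positive. -/
theorem IsLatticePolygon.edgeSum_supportFun_pos {P R : Set (Fin 2 → ℝ)} (hP : IsLatticePolygon P)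
    (hdim : (interior P).Nonempty) (hR : IsBody R) (hint : (interior R).Nonempty) :
    0 < edgeSum P (supportFun R) := by
  have hB := hP.isBody
  have harea : 0 < area P :=
    ENNReal.toReal_pos (Measure.measure_pos_of_nonempty_interior volume hdim).ne'
      hB.compact.measure_lt_top.ne
  obtain ⟨r, hr⟩ := hint
  -- A small translated copy of `P` inside `R` already has mixed area `2 * ε * area P` with `P`, and
  -- the edge sum is monotone in the support function.
  obtain ⟨ε, hε, hsub⟩ : ∃ ε : ℝ, 0 < ε ∧ {r} + ε • P ⊆ R := by
    obtain ⟨δ, hδ, hball⟩ := Metric.isOpen_iff.1 isOpen_interior r hr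
    obtain ⟨C, hC0, hC⟩ := hB.compact.isBounded.exists_pos_norm_le
    refine ⟨δ / (2 * C), by positivity, ?_⟩
    rw [singleton_add]
    rintro _ ⟨_, ⟨x, hx, rfl⟩, rfl⟩
    refine interior_subset (hball ?_)
    rw [Metric.mem_ball, dist_eq_norm, add_sub_cancel_left, norm_smul, Real.norm_of_nonneg
      (by positivity)]
    calc δ / (2 * C) * ‖x‖ ≤ δ / (2 * C) * C := by gcongr; exact hC x hx
      _ = δ / 2 := by field_simp
      _ < δ := by linarith
  have h1 : edgeSum P (supportFun ({r} + ε • P)) = ε * (2 * area P) := by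
    have e : supportFun ({r} + ε • P) = fun v => supportFun {r} v + ε * supportFun P v := by
      funext v
      rw [(IsBody.singleton r).supportFun_add (hB.smul ε), hB.supportFun_smul_set hε.le]
    have hr0 : edgeSum P (supportFun {r}) = 0 := by
      rw [← hP.mixedArea_eq (IsBody.singleton r), mixedArea, add_comm P, area_singleton_add,
        area_singleton]
      ring
    rw [e, hP.edgeSum_add_right, hP.edgeSum_const_mul, hr0, ← hP.mixedArea_eq hB,
      hB.mixedArea_self, zero_add]
  have h2 := hP.edgeSum_mono (((IsBody.singleton r).add (hB.smul ε)).supportFun_mono hR hsub)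
  rw [h1] at h2
  exact lt_of_lt_of_le (by positivity) h2

end

/-! ### The characterisation -/

theorem mainTheorem3 (P₁ P₂ A R₁ R₂ : Set (Fin 2 → ℝ))
    (hP₁ : IsLatticePolygon P₁) (hR₁ : IsLatticePolygon R₁) (hR₂ : IsLatticePolygon R₂)
    (hdim : (interior P₁).Nonempty)
    (hA : A = P₁ + R₁) (hP₂ : P₂ = A + R₂) :
    (mixedArea P₁ A < mixedArea P₁ P₂ ∧
      (2 : ℝ) • A ⊆ interior (P₁ + P₂) ∧
      (latticeCount A : ℝ) - (latticeCount (minkowskiDiff A P₁) : ℝ) = mixedArea P₁ P₂ / 2) ↔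
    (R₁ ⊆ interior R₂ ∧
      ∀ v ∈ fan P₁, supportFun R₂ (latticePt v) = supportFun R₁ (latticePt v) + 1) := by
  have bP := hP₁.isBody
  have bR₁ := hR₁.isBody
  have bR₂ := hR₂.isBody
  have bA : IsBody A := hA ▸ bP.add bR₁
  have bP₂ : IsBody P₂ := hP₂ ▸ bA.add bR₂
  have hsA : supportFun A = fun v => supportFun P₁ v + supportFun R₁ v := by
    funext v; rw [hA, bP.supportFun_add bR₁]
  have hsP₂ : supportFun P₂ = fun v => supportFun A v + supportFun R₂ v := by
    funext v; rw [hP₂, bA.supportFun_add bR₂]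
  set M₁ := edgeSum P₁ (supportFun R₁) with hM₁
  set M₂ := edgeSum P₁ (supportFun R₂) with hM₂
  have mA : mixedArea P₁ A = 2 * area P₁ + M₁ := by
    rw [hP₁.mixedArea_eq bA, hsA, hP₁.edgeSum_add_right, ← hP₁.mixedArea_eq bP, bP.mixedArea_self]
  have mP₂ : mixedArea P₁ P₂ = 2 * area P₁ + M₁ + M₂ := by
    rw [hP₁.mixedArea_eq bP₂, hsP₂, hP₁.edgeSum_add_right, ← hP₁.mixedArea_eq bA, mA]
  have hii : (2 : ℝ) • A ⊆ interior (P₁ + P₂) ↔ R₁ ⊆ interior R₂ := by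
    have hsum : ∀ v, supportFun (P₁ + P₂) v - supportFun ((2 : ℝ) • A) v =
        supportFun R₂ v - supportFun R₁ v := by
      intro v
      rw [bP.supportFun_add bP₂, bA.supportFun_smul_set zero_le_two, hsP₂, hsA]
      ring
    constructor
    · intro h
      refine bR₁.subset_interior_of_supportFun_lt bR₂ fun v hv => ?_
      have := (bA.smul 2).supportFun_lt_of_subset_interior (bP.add bP₂) h hv
      linarith [hsum v]
    · intro h
      refine (bA.smul 2).subset_interior_of_supportFun_lt (bP.add bP₂) fun v hv => ?_
      have := bR₁.supportFun_lt_of_subset_interior bR₂ h hv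
      linarith [hsum v]
  -- With A - P₁ = R₁ and Pick's formula for A and R₁, twice (iii) reads 2 area(P₁) + 2M₁ + `edgeSum
  -- P₁ 1` = 2 area(P₁) + M₁ + M₂.
  have hiii : (latticeCount A : ℝ) - (latticeCount (minkowskiDiff A P₁) : ℝ) =
      mixedArea P₁ P₂ / 2 ↔
      edgeSum P₁ (fun v => supportFun R₂ v + -1 * (supportFun R₁ v + 1)) = 0 := by
    have p₁ := (hP₁.add hR₁).pick
    have p₂ := hR₁.pick
    rw [hP₁.edgeSum_add hR₁] at p₁
    have p₃ := hP₁.mixedArea_eq bR₁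
    rw [mixedArea] at p₃
    rw [hP₁.edgeSum_add_right, hP₁.edgeSum_const_mul, hP₁.edgeSum_add_right, mP₂, hA,
      bP.minkowskiDiff_add_eq bR₁]
    constructor <;> intro h <;> linarith
  rw [hii, hiii]
  -- Both support values are integers at a lattice vector, so a strict inequality leaves a gap of at
  -- least one.
  have hterm : R₁ ⊆ interior R₂ → ∀ v ∈ fan P₁,
      0 ≤ supportFun R₂ (latticePt v) + -1 * (supportFun R₁ (latticePt v) + 1) := by
    intro h v hv
    have hlt := bR₁.supportFun_lt_of_subset_interior bR₂ h (latticePt_ne_zero hv.1)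
    obtain ⟨m, hm⟩ := hR₂.exists_supportFun_eq v
    obtain ⟨k, hk⟩ := hR₁.exists_supportFun_eq v
    rw [hm, hk] at hlt ⊢
    have h1 : k + 1 ≤ m := Int.add_one_le_iff.2 (by exact_mod_cast hlt)
    have h2 : (k : ℝ) + 1 ≤ m := by exact_mod_cast h1
    linarith
  constructor
  · rintro ⟨-, h, h0⟩
    refine ⟨h, fun v hv => ?_⟩
    have := (hP₁.edgeSum_eq_zero_iff (hterm h)).1 h0 v hv
    linarith
  · rintro ⟨h, h1⟩
    refine ⟨?_, h, (hP₁.edgeSum_eq_zero_iff (hterm h)).2 fun v hv => ?_⟩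
    · have := hP₁.edgeSum_supportFun_pos hdim bR₂ (bR₁.nonempty.mono h)
      rw [mA, mP₂]
      linarith
    · rw [h1 v hv]
      ring
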